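/- Let $\mathcal G$ be a finite simple undirected graph with two distinct nodes $m_1,m_2$ (the monitors) that are not joined by a link. The \emph{interior graph} $\mathcal H$ is obtained from $\mathcal G$ by deleting $m_1$, $m_2$ and all links incident with them; the links of $\mathcal H$ are the \emph{interior links}. Write $V(\cdot)$ and $L(\cdot)$ for node and link sets. A \emph{face} of $\mathcal G$ is a cycle $\mathcal C$ in $\mathcal G$ that is an induced subgraph of $\mathcal G$ and such that every connected component of $\mathcal G-V(\mathcal C)$ contains $m_1$ or $m_2$. An interior link $vw$ is a \emph{border-link} if there do \emph{not} exist a face $\mathcal C_1$, a cycle $\mathcal C_2$ and two paths $\mathcal P_1,\mathcal P_2$ in $\mathcal G$ (possibly consisting of a single node) such that \begin{itemize} \item $vw\in L(\mathcal C_1)\cap L(\mathcal C_2)$ and $V(\mathcal C_1)\cap V(\mathcal C_2)=\{v,w\}$; \item $\mathcal P_1$ starts at one of the two monitors and $\mathcal P_2$ starts at the other one, and $V(\mathcal P_1)\cap V(\mathcal P_2)=\emptyset$; \item $\mathcal P_1$ ends at a node of $\mathcal C_1$ and has no other node in common with $\mathcal C_1$ and none with $\mathcal C_2$; \item $\mathcal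 P_2$ ends at a node of $\mathcal C_2$ and has no other node in common with $\mathcal C_2$ and none with $\mathcal C_1$. \end{itemize} Assume that \begin{itemize} \item[①] $\mathcal G-l$ is 2-edge-connected for every interior link $l$; \item[②] $\mathcal G+m_1m_2$ is 3-vertex-connected (it has more than three nodes, and deleting any set of at most two nodes leaves it connected). \end{itemize} Then: \begin{itemize} \item[(a)] every face of $\mathcal G$ contains at most one border-link; \item[(b)] every border-link lies on some face of $\mathcal G$ that contains neither $m_1$ nor $m_2$; \item[(c)] if a border-link lies on a face $\mathcal C_1$ all of whose links are interior, then its two ends can be named $v$ and $w$ in such a way that there are vertex-disjoint paths $\mathcal P(m_1,v)$, from $m_1$ to $v$, and $\mathcal P(m_2,w)$, from $m_2$ to $w$, that have no node in common with $\mathcal C_1$ except $v$ and $w$, respectively. \end{itemize} -/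

import Mathlib

namespace TwoMonitor

variable {V : Type*}

/-- `k`-vertex-connectivity: more than `k` nodes, and the graph stays connected when any set of
fewer than `k` nodes is deleted. -/
def IsVertexConnected (k : ℕ) (G : SimpleGraph V) : Prop :=
  (k : ℕ∞) < ENat.card V ∧ ∀ S : Set V, S.encard < k → (G.induce Sᶜ).Connected

/-- The interior graph: the monitors and all links incident with them are deleted. -/
def interiorGraph (G : SimpleGraph V) (m₁ m₂ : V) : G.Subgraph :=
  (⊤ : G.Subgraph).deleteVerts {m₁, m₂}

/-- A subgraph of `G` that is a cycle (with at least three nodes). -/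
def IsCycleSubgraph {G : SimpleGraph V} (C : G.Subgraph) : Prop :=
  ∃ (u : V) (p : G.Walk u u), p.IsCycle ∧ p.toSubgraph = C

/-- A face of a graph with two monitors: a cycle that is an induced subgraph and whose deletion
separates no node from the monitors, that is, every connected component of what remains contains
a monitor. -/
structure IsFace {G : SimpleGraph V} (m₁ m₂ : V) (C : G.Subgraph) : Prop where
  isCycle : IsCycleSubgraph C
  isInduced : C.IsInduced
  exists_monitor : ∀ K : (G.induce C.vertsᶜ).ConnectedComponent,
    ∃ x ∈ K.supp, (x : V) = m₁ ∨ (x : V) = m₂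

/-- The link `e` is of Type 1: it is the common link of a face `C₁` and a cycle `C₂` that share no
node except the two ends of `e`, and there are node-disjoint paths `P₁`, `P₂` that start at
different monitors, such that `P₁` avoids `C₂` and meets `C₁` exactly in its last node, while
`P₂` avoids `C₁` and meets `C₂` exactly in its last node. -/
def IsTypeOneLink (G : SimpleGraph V) (m₁ m₂ : V) (e : Sym2 V) : Prop :=
  ∃ C₁ C₂ : G.Subgraph,
    IsFace m₁ m₂ C₁ ∧ IsCycleSubgraph C₂ ∧ e ∈ C₁.edgeSet ∧ e ∈ C₂.edgeSet ∧
    C₁.verts ∩ C₂.verts = {z | z ∈ e} ∧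
    ∃ a b : V, ((a = m₁ ∧ b = m₂) ∨ (a = m₂ ∧ b = m₁)) ∧
    ∃ (x y : V) (P₁ : G.Path a x) (P₂ : G.Path b y),
      (∀ z ∈ P₁.1.support, z ∉ P₂.1.support) ∧
      x ∈ C₁.verts ∧ (∀ z ∈ P₁.1.support, z ∈ C₁.verts → z = x) ∧
      (∀ z ∈ P₁.1.support, z ∉ C₂.verts) ∧
      y ∈ C₂.verts ∧ (∀ z ∈ P₂.1.support, z ∈ C₂.verts → z = y) ∧
      (∀ z ∈ P₂.1.support, z ∉ C₁.verts)

/-- A border-link: an interior link that is not of Type 1. -/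
def IsBorderLink (G : SimpleGraph V) (m₁ m₂ : V) (e : Sym2 V) : Prop :=
  e ∈ (interiorGraph G m₁ m₂).edgeSet ∧ ¬ IsTypeOneLink G m₁ m₂ e

end TwoMonitor

/-! Everything is reduced to `Split`: disjoint connected sets around `m₁` and `m₂` that miss `v`,
`w` and are both adjacent to each of them. A split makes `vw` a Type 1 link (`Split.isTypeOneLink`),
so a border-link has none. The face needed there comes from an argument in the style of Tutte: in
the 3-connected graph `G + m₁m₂`, a connected set, maximal among those that leave `v` and `w` joined
without the link `vw`, has a chordless cycle as complement (`exists_hole_compl_connSet`). If the set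
holds a monitor, the cycle is a face of `G`.

A face through a monitor splits each of its interior links, so every face through a border-link
misses both monitors. Together with the existence of a face through the link, this is (b).

For (a) and (c), let `C` be such a face and `L` a stretch of it. Menger's theorem off `C`, from the
monitors to the neighbours of `L`, gives either a partition of the complement of `C` into connected
parts around the monitors, both attached to `L`, or one node `t` that separates `L` from the
monitors.

In (c), `L` is all of `C`. A separator would form a separating pair with an end of the link. A
partition must be attached crosswise to the two ends, since otherwise it splits the link.

In (a), two border-links cut `C` into two stretches. A partition with both parts attached to a
stretch of at least two nodes would split one of the links (`false_of_attachments`), so such a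
stretch has a separator. If the other stretch is a single node, this node and the separator form a
separating pair of `G + m₁m₂`. Otherwise the two separators must be the monitors, and the two
border-links form an edge cut of `G`, against condition ①. -/

namespace TwoMonitor

open SimpleGraph

/-! ### Walks and connectivity inside a set of nodes -/

section Reach

variable {V : Type*} {G H : SimpleGraph V} {S S' A B R T : Set V} {x y z : V}

/-- `y` can be reached from `x` by a walk all of whose nodes lie in `S`. -/
def ReachIn (G : SimpleGraph V) (S : Set V) (x y : V) : Prop :=
  ∃ p : G.Walk x y, ∀ z ∈ p.support, z ∈ S

/-- Any two nodes of `S` are joined by a walk inside `S`. -/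
def ConnSet (G : SimpleGraph V) (S : Set V) : Prop :=
  ∀ x ∈ S, ∀ y ∈ S, ReachIn G S x y

/-- Some node of `X` is adjacent to `v`. -/
def Att (G : SimpleGraph V) (X : Set V) (v : V) : Prop := ∃ x ∈ X, G.Adj x v

theorem ReachIn.refl (hx : x ∈ S) : ReachIn G S x x := ⟨.nil, by simpa using hx⟩

theorem ReachIn.left_mem (h : ReachIn G S x y) : x ∈ S := by
  obtain ⟨p, hp⟩ := h; exact hp _ p.start_mem_support

theorem ReachIn.right_mem (h : ReachIn G S x y) : y ∈ S := by
  obtain ⟨p, hp⟩ := h; exact hp _ p.end_mem_support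

theorem ReachIn.symm (h : ReachIn G S x y) : ReachIn G S y x := by
  obtain ⟨p, hp⟩ := h; exact ⟨p.reverse, by simpa using hp⟩

theorem ReachIn.trans (h : ReachIn G S x y) (h' : ReachIn G S y z) : ReachIn G S x z := by
  obtain ⟨p, hp⟩ := h
  obtain ⟨q, hq⟩ := h'
  refine ⟨p.append q, fun t ht => ?_⟩
  rw [Walk.mem_support_append_iff] at ht
  exact ht.elim (hp t) (hq t)

theorem ReachIn.mono (h : ReachIn G S x y) (hS : S ⊆ S') : ReachIn G S' x y := by
  obtain ⟨p, hp⟩ := h; exact ⟨p, fun t ht => hS (hp t ht)⟩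

theorem ReachIn.of_adj (h : G.Adj x y) (hx : x ∈ S) (hy : y ∈ S) : ReachIn G S x y :=
  ⟨.cons h .nil, by simp [hx, hy]⟩

/-- Induction from the start of a walk inside `S`: a set closed under steps inside `S`
contains the end. -/
theorem ReachIn.mem_of_closed (h : ReachIn G S x y) {K : Set V} (hx : x ∈ K)
    (hK : ∀ u ∈ K, ∀ v ∈ S, G.Adj u v → v ∈ K) : y ∈ K := by
  obtain ⟨p, hp⟩ := h
  induction p with
  | nil => exact hx
  | cons h p ih =>
    refine ih (hK _ hx _ (hp _ (by simp)) h) fun z hz => hp z (by simp [hz])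

/-- Restriction to a smaller graph that keeps all edges inside `S` which the walk can use. -/
theorem ReachIn.map_adj (h : ReachIn G S x y)
    (hGH : ∀ u ∈ S, ∀ v ∈ S, G.Adj u v → H.Adj u v) : ReachIn H S x y := by
  have hx := h.left_mem
  refine (h.mem_of_closed (K := {z | ReachIn H S x z}) (.refl hx) ?_)
  intro u hu v hv huv
  exact ReachIn.trans hu (.of_adj (hGH u hu.right_mem v hv huv) hu.right_mem hv)

theorem ReachIn.avoid_or (h : ReachIn G S x y) (s : V) :
    ReachIn G (S \ {s}) x y ∨ (ReachIn G S x s ∧ ReachIn G S s y) := by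
  classical
  obtain ⟨p, hp⟩ := h
  by_cases hs : s ∈ p.support
  · right
    exact ⟨⟨p.takeUntil s hs, fun z hz => hp z (p.support_takeUntil_subset_support hs hz)⟩,
      ⟨p.dropUntil s hs, fun z hz => hp z (p.support_dropUntil_subset_support hs hz)⟩⟩
  · left
    exact ⟨p, fun z hz => ⟨hp z hz, fun h => hs (by rw [Set.mem_singleton_iff] at h; rwa [← h])⟩⟩

theorem ReachIn.exists_first (h : ReachIn G S x y) (hy : y ∈ T) :
    ∃ t ∈ T, t ∈ S ∧ ReachIn G (insert t (S \ T)) x t := by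
  obtain ⟨p, hp⟩ := h
  induction p with
  | nil => exact ⟨_, hy, hp _ (by simp), .refl (by simp)⟩
  | @cons u v w h p ih =>
    by_cases hu : u ∈ T
    · exact ⟨u, hu, hp _ (by simp), .refl (by simp)⟩
    · obtain ⟨t, ht, htS, hr⟩ := ih hy fun z hz => hp z (by simp [hz])
      exact ⟨t, ht, htS, ReachIn.trans
        (.of_adj h (Or.inr ⟨hp _ (by simp), hu⟩) hr.left_mem) hr⟩

theorem ReachIn.exists_path (h : ReachIn G S x y) : ∃ p : G.Path x y, ∀ z ∈ p.1.support, z ∈ S := by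
  classical
  obtain ⟨p, hp⟩ := h
  exact ⟨p.toPath, fun z hz => hp z (p.support_toPath_subset_support hz)⟩

/-- A path from `x` to the first node in `T`. -/
theorem ReachIn.exists_path_first (h : ReachIn G S x y) (hy : y ∈ T) :
    ∃ t ∈ T, ∃ p : G.Path x t, (∀ z ∈ p.1.support, z ∈ S) ∧
      ∀ z ∈ p.1.support, z ∈ T → z = t := by
  obtain ⟨t, ht, htS, hr⟩ := h.exists_first hy
  obtain ⟨p, hp⟩ := hr.exists_path
  refine ⟨t, ht, p, fun z hz => ?_, fun z hz hzT => ?_⟩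
  · rcases hp z hz with rfl | h
    · exact htS
    · exact h.1
  · rcases hp z hz with rfl | h
    · rfl
    · exact absurd hzT h.2

theorem ConnSet.singleton (x : V) : ConnSet G {x} := by
  rintro _ rfl _ rfl
  exact .refl rfl

theorem ConnSet.reach (x : V) : ConnSet G {z | ReachIn G S x z} := by
  have key : ∀ y, ReachIn G S x y → ReachIn G {z | ReachIn G S x z} x y := by
    intro y hy
    refine hy.mem_of_closed (K := {y | ReachIn G {z | ReachIn G S x z} x y})
      (.refl (ReachIn.refl hy.left_mem)) ?_
    intro u hu v hv huv
    have h1 : ReachIn G S x u := hu.right_mem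
    exact ReachIn.trans hu (.of_adj huv h1 (h1.trans (.of_adj huv h1.right_mem hv)))
  intro y hy z hz
  exact (key y hy).symm.trans (key z hz)

theorem ConnSet.union (hA : ConnSet G A) (hB : ConnSet G B)
    (h : ∃ x ∈ A, ∃ y ∈ B, G.Adj x y) : ConnSet G (A ∪ B) := by
  obtain ⟨a, ha, b, hb, hab⟩ := h
  have key : ∀ z ∈ A ∪ B, ReachIn G (A ∪ B) a z := by
    rintro z (hz | hz)
    · exact (hA a ha z hz).mono Set.subset_union_left
    · exact ReachIn.trans (.of_adj hab (.inl ha) (.inr hb))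
        ((hB b hb z hz).mono Set.subset_union_right)
  intro x hx y hy
  exact (key x hx).symm.trans (key y hy)

theorem ConnSet.insert (hA : ConnSet G A) (h : ∃ x ∈ A, G.Adj x y) :
    ConnSet G (insert y A) := by
  obtain ⟨x, hx, hxy⟩ := h
  rw [Set.insert_eq, Set.union_comm]
  exact hA.union (.singleton y) ⟨x, hx, y, rfl, hxy⟩

theorem ConnSet.map_adj (hA : ConnSet G A)
    (hGH : ∀ u ∈ A, ∀ v ∈ A, G.Adj u v → H.Adj u v) : ConnSet H A :=
  fun x hx y hy => (hA x hx y hy).map_adj hGH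

theorem ConnSet.image_Icc {c : ℕ → V} {i j : ℕ}
    (h : ∀ t, i ≤ t → t < j → G.Adj (c t) (c (t + 1))) : ConnSet G (c '' Set.Icc i j) := by
  have key : ∀ t, i ≤ t → t ≤ j → ReachIn G (c '' Set.Icc i j) (c i) (c t) := by
    intro t hit
    induction t, hit using Nat.le_induction with
    | base => exact fun hj => .refl ⟨i, ⟨le_rfl, hj⟩, rfl⟩
    | succ t hit ih =>
      intro htj
      exact (ih (by omega)).trans (.of_adj (h t hit (by omega)) ⟨t, ⟨hit, by omega⟩, rfl⟩
        ⟨t + 1, ⟨by omega, htj⟩, rfl⟩)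
  rintro _ ⟨s, hs, rfl⟩ _ ⟨t, ht, rfl⟩
  exact (key s hs.1 hs.2).symm.trans (key t ht.1 ht.2)

theorem Att.mono {v : V} (h : Att G A v) (hAB : A ⊆ B) : Att G B v := by
  obtain ⟨x, hx, h⟩ := h; exact ⟨x, hAB hx, h⟩

end Reach

/-! ### Menger's theorem for two paths, and partitions around two terminals -/

section Menger

variable {V : Type*} [Finite V]

/-- Menger's theorem for two disjoint paths from `{a, b}` to `T` inside `R`. -/
theorem exists_disjoint_connSet_or_separator (G : SimpleGraph V) (R T : Set V) {a b : V}
    (ha : a ∈ R) (hab : a ≠ b) :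
    (∃ A B : Set V, ConnSet G A ∧ ConnSet G B ∧ Disjoint A B ∧ a ∈ A ∧ b ∈ B ∧ A ⊆ R ∧ B ⊆ R ∧
      (∃ x ∈ A, x ∈ T) ∧ ∃ x ∈ B, x ∈ T) ∨
    ∃ s, ∀ x, (x = a ∨ x = b) → ∀ y ∈ T, ¬ ReachIn G (R \ {s}) x y := by
  by_contra hcon
  push Not at hcon
  obtain ⟨hno, hsep⟩ := hcon
  -- Push a connected set around `a` as far as possible while `b` can still reach `T` off it.
  let F : Set (Set V) :=
    {A | a ∈ A ∧ A ⊆ R ∧ ConnSet G A ∧ b ∉ A ∧ ∃ y ∈ T, ReachIn G (R \ A) b y}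
  have hF : F.Nonempty := by
    refine ⟨{a}, rfl, by simpa using ha, .singleton a, fun h => hab h.symm, ?_⟩
    obtain ⟨x, rfl | rfl, y, hy, hr⟩ := hsep a
    · exact absurd rfl hr.left_mem.2
    · exact ⟨y, hy, hr⟩
  obtain ⟨A, ⟨haA, hAR, hA, hbA, y₀, hy₀, hr₀⟩, hmax⟩ := (Set.toFinite F).exists_maximal hF
  have hAT : ∀ x ∈ A, x ∉ T := fun x hx hxT =>
    hno A {z | ReachIn G (R \ A) b z} hA (.reach b)
      (Set.disjoint_left.2 fun z hz (hz' : ReachIn _ _ _ _) => hz'.right_mem.2 hz) haA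
      (ReachIn.refl hr₀.left_mem) hAR (fun z (hz : ReachIn _ _ _ _) => hz.right_mem.1)
      ⟨x, hx, hxT⟩ y₀ hr₀ hy₀
  let N : Set V := {x | x ∈ R ∧ x ∉ A ∧ Att G A x}
  -- By maximality, absorbing a neighbour `x` of `A` must cut `b` from `T`.
  have hN : ∀ x ∈ N, ∀ y ∈ T, ¬ ReachIn G ((R \ A) \ {x}) b y := by
    rintro x ⟨hxR, hxA, hatt⟩ y hy hr
    have hle := hmax (y := insert x A) ⟨.inr haA, Set.insert_subset hxR hAR, hA.insert hatt,
      fun h => h.elim (fun h => hr.left_mem.2 h) hbA, y, hy,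
      hr.mono fun z hz => ⟨hz.1.1, fun h => h.elim hz.2 hz.1.2⟩⟩ (Set.subset_insert x A)
    exact hxA (hle (.inl rfl))
  have hNne : N.Nonempty := by
    obtain ⟨x, rfl | rfl, y, hy, hr⟩ := hsep b
    · by_contra hNe
      refine hAT y (hr.mem_of_closed haA fun u hu v hv huv => ?_) hy
      by_contra hvA
      exact hNe ⟨v, hv.1, hvA, u, hu, huv⟩
    · exact absurd rfl hr.left_mem.2
  -- `D s` is what lies beyond `s` towards `T`. The cut node nearest to `T` minimises it; as `s`
  -- alone is no separator, `D s` contains another neighbour `z` of `A`, and `D z` is smaller.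
  let D : V → Set V := fun s => {z | ∃ y ∈ T, ReachIn G ((R \ A) \ {s}) z y}
  obtain ⟨s, hsN, hsmin⟩ := Set.exists_min_image N (fun s => (D s).ncard) (Set.toFinite N) hNne
  obtain ⟨x, hx, y, hy, hr⟩ := hsep s
  have hyD : y ∈ D s :=
    ⟨y, hy, .refl ⟨⟨hr.right_mem.1, fun h => hAT y h hy⟩, hr.right_mem.2⟩⟩
  have hxD : x ∉ D s := by
    rintro ⟨y', hy', hr'⟩
    rcases hx with rfl | rfl
    · exact hr'.left_mem.1.2 haA
    · exact hN s hsN y' hy' hr'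
  obtain ⟨z, hzD, hzA, hzN⟩ : ∃ z ∈ D s, z ∉ A ∧ z ∈ N := by
    by_contra hno'
    push Not at hno'
    refine hxD (hr.symm.mem_of_closed hyD fun u hu v hv huv => ?_)
    obtain ⟨y', hy', hr'⟩ := hu
    have huA := hr'.left_mem.1.2
    have hvA : v ∉ A := fun hvA => hno' u ⟨y', hy', hr'⟩ huA
      ⟨hr'.left_mem.1.1, huA, v, hvA, huv.symm⟩
    exact ⟨y', hy', ReachIn.trans (.of_adj huv.symm ⟨⟨hv.1, hvA⟩, hv.2⟩ hr'.left_mem) hr'⟩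
  obtain ⟨y₁, hy₁, hr₁⟩ := hzD
  have hzs : z ≠ s := fun h => hr₁.left_mem.2 h
  have hsT : ∀ y ∈ T, ¬ ReachIn G ((R \ A) \ {z}) s y := by
    intro y₂ hy₂ hr₂
    have hbs : ReachIn G (R \ A) b s :=
      ((hr₀.avoid_or s).resolve_left (hN s hsN y₀ hy₀)).1
    -- Whichever of `s`, `z` is met first can be followed to `T` without the other, although both
    -- cut `b` from `T`.
    obtain ⟨t, ht, -, hrt⟩ := hbs.exists_first (T := {s, z}) (by simp)
    rcases ht with rfl | rfl
    · refine hN z hzN y₂ hy₂ (ReachIn.trans (hrt.mono ?_) hr₂)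
      rintro u (rfl | hu)
      · exact hr₂.left_mem
      · exact ⟨hu.1, fun h => hu.2 (.inr h)⟩
    · refine hN s hsN y₁ hy₁ (ReachIn.trans (hrt.mono ?_) hr₁)
      rintro u (rfl | hu)
      · exact hr₁.left_mem
      · exact ⟨hu.1, fun h => hu.2 (.inl h)⟩
  have hsub : D z ⊆ D s := by
    rintro u ⟨y₂, hy₂, hr₂⟩
    rcases hr₂.avoid_or s with h | h
    · exact ⟨y₂, hy₂, h.mono fun w hw => ⟨hw.1.1, hw.2⟩⟩
    · exact absurd h.2 (hsT y₂ hy₂)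
  have hlt : (D z).ncard < (D s).ncard := by
    refine Set.ncard_lt_ncard ⟨hsub, fun h => ?_⟩ (Set.toFinite _)
    obtain ⟨y₂, hy₂, hr₂⟩ := h ⟨y₁, hy₁, hr₁⟩
    exact hr₂.left_mem.2 rfl
  exact absurd (hsmin z hzN) (not_le.2 hlt)

/-- Disjoint connected sets around two terminals extend to a partition, provided that every node
reaches one of the terminals. -/
theorem exists_partition (G : SimpleGraph V) {R A B : Set V} {a b : V}
    (hR : ∀ r ∈ R, ReachIn G R r a ∨ ReachIn G R r b) (hA : ConnSet G A) (hB : ConnSet G B)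
    (hAB : Disjoint A B) (haA : a ∈ A) (hbB : b ∈ B) (hAR : A ⊆ R) (hBR : B ⊆ R) :
    ∃ A' B' : Set V, A ⊆ A' ∧ B ⊆ B' ∧ ConnSet G A' ∧ ConnSet G B' ∧ Disjoint A' B' ∧
      A' ∪ B' = R := by
  let F : Set (Set V × Set V) := {P | A ⊆ P.1 ∧ B ⊆ P.2 ∧ ConnSet G P.1 ∧ ConnSet G P.2 ∧
    Disjoint P.1 P.2 ∧ P.1 ⊆ R ∧ P.2 ⊆ R}
  obtain ⟨⟨A', B'⟩, ⟨h1, h2, h3, h4, h5, h6, h7⟩, hmax⟩ := (Set.toFinite F).exists_maximal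
    ⟨(A, B), subset_rfl, subset_rfl, hA, hB, hAB, hAR, hBR⟩
  dsimp only at h1 h2 h3 h4 h5 h6 h7
  refine ⟨A', B', h1, h2, h3, h4, h5, (Set.union_subset h6 h7).antisymm fun r hr => ?_⟩
  have key : ∀ u ∈ A' ∪ B', ∀ v ∈ R, G.Adj u v → v ∈ A' ∪ B' := by
    intro u hu v hv huv
    by_contra hv'
    have hvA : v ∉ A' := fun h => hv' (.inl h)
    have hvB : v ∉ B' := fun h => hv' (.inr h)
    rcases hu with hu | hu
    · have := hmax (y := (insert v A', B')) ⟨h1.trans (Set.subset_insert _ _), h2,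
        h3.insert ⟨u, hu, huv⟩, h4, Set.disjoint_insert_left.2 ⟨hvB, h5⟩,
        Set.insert_subset hv h6, h7⟩ ⟨Set.subset_insert _ _, le_rfl⟩
      exact hvA (this.1 (.inl rfl))
    · have := hmax (y := (A', insert v B')) ⟨h1, h2.trans (Set.subset_insert _ _), h3,
        h4.insert ⟨u, hu, huv⟩, Set.disjoint_insert_right.2 ⟨hvA, h5⟩,
        h6, Set.insert_subset hv h7⟩ ⟨le_rfl, Set.subset_insert _ _⟩
      exact hvB (this.2 (.inl rfl))
  rcases hR r hr with h | h
  · exact h.symm.mem_of_closed (.inl (h1 haA)) key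
  · exact h.symm.mem_of_closed (.inr (h2 hbB)) key

end Menger

/-! ### Chordless cycles as indexed sequences -/

section Holes

variable {V : Type*} {G H : SimpleGraph V}

/-- `c 0, …, c n` is a chordless cycle of `G` (the link from `c n` to `c 0` included). -/
structure IsHole (G : SimpleGraph V) (c : ℕ → V) (n : ℕ) : Prop where
  two_le : 2 ≤ n
  inj : ∀ i ≤ n, ∀ j ≤ n, c i = c j → i = j
  adj : ∀ i < n, G.Adj (c i) (c (i + 1))
  closing : G.Adj (c n) (c 0)
  chord : ∀ i j, i < j → j ≤ n → G.Adj (c i) (c j) → j = i + 1 ∨ (i = 0 ∧ j = n)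

theorem IsHole.reverse {c : ℕ → V} {n : ℕ} (h : IsHole G c n) :
    IsHole G (fun i => c (n - i)) n where
  two_le := h.two_le
  inj i hi j hj hij := by
    have := h.inj (n - i) (by omega) (n - j) (by omega) hij
    omega
  adj i hi := by
    have := (h.adj (n - (i + 1)) (by omega)).symm
    rwa [show n - (i + 1) + 1 = n - i by omega] at this
  closing := by simpa using h.closing.symm
  chord i j hij hj hadj := by
    have := h.chord (n - j) (n - i) (by omega) (by omega) hadj.symm
    omega

/-- The two neighbours on a chordless cycle are the only neighbours on it. -/
theorem IsHole.exists_pair {c : ℕ → V} {n : ℕ} (h : IsHole G c n) {i : ℕ} (hi : i ≤ n) :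
    ∃ p q, (∃ j ≤ n, c j = p ∧ j ≠ i) ∧ (∃ j ≤ n, c j = q ∧ j ≠ i) ∧
      ∀ j ≤ n, G.Adj (c i) (c j) → c j = p ∨ c j = q := by
  have h2 := h.two_le
  refine ⟨c (if i = 0 then n else i - 1), c (if i = n then 0 else i + 1),
    ⟨_, ?_, rfl, ?_⟩, ⟨_, ?_, rfl, ?_⟩, fun j hj hadj => ?_⟩
  · split_ifs <;> omega
  · split_ifs <;> omega
  · split_ifs <;> omega
  · split_ifs <;> omega
  · rcases lt_trichotomy i j with hij | rfl | hij
    · rcases h.chord i j hij hj hadj with rfl | ⟨rfl, rfl⟩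
      · right; rw [if_neg (by omega)]
      · left; simp
    · exact absurd rfl hadj.ne
    · rcases h.chord j i hij hi hadj.symm with rfl | ⟨rfl, rfl⟩
      · left; simp
      · right; simp

end Holes

/-! ### Non-separating chordless cycles in a 3-connected graph -/

section ThreeConnected

variable {V : Type*} {G H : SimpleGraph V}

/-- No two nodes separate, and there is a fourth node next to any three. -/
structure NoTwoSep (H : SimpleGraph V) : Prop where
  reach : ∀ p q x y : V, x ≠ p → x ≠ q → y ≠ p → y ≠ q → ReachIn H {p, q}ᶜ x y
  exists_ne : ∀ p q r : V, ∃ z, z ≠ p ∧ z ≠ q ∧ z ≠ r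

theorem ReachIn.of_induce {S : Set V} {x y : S} (h : (G.induce S).Reachable x y) :
    ReachIn G S x y := by
  obtain ⟨p⟩ := h
  induction p with
  | nil => exact .refl (Subtype.coe_prop _)
  | cons h p ih => exact ReachIn.trans (.of_adj h (Subtype.coe_prop _) (Subtype.coe_prop _)) ih

theorem IsVertexConnected.noTwoSep (h : IsVertexConnected 3 H) : NoTwoSep H where
  reach p q x y hxp hxq hyp hyq := by
    have hlt : ({p, q} : Set V).encard < (3 : ℕ) :=
      (Set.encard_insert_le _ _).trans_lt (by rw [Set.encard_singleton]; norm_num)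
    exact ReachIn.of_induce ((h.2 _ hlt).preconnected
      ⟨x, by simp [hxp, hxq]⟩ ⟨y, by simp [hyp, hyq]⟩)
  exists_ne p q r := by
    by_contra hno
    push Not at hno
    have hu : (Set.univ : Set V) ⊆ {p, q, r} := by
      intro z _
      by_cases h1 : z = p
      · simp [h1]
      by_cases h2 : z = q
      · simp [h2]
      simp [hno z h1 h2]
    have h1 := h.1
    rw [← Set.encard_univ] at h1
    have h2 : ({p, q, r} : Set V).encard ≤ 3 := by
      refine (Set.encard_insert_le _ _).trans ?_
      refine (add_le_add_left (Set.encard_insert_le _ _) 1).trans ?_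
      rw [Set.encard_singleton]; norm_num
    exact absurd (h1.trans_le ((Set.encard_le_encard hu).trans h2)) (lt_irrefl _)

/-- In a graph without separating pairs of nodes, a set has at least three neighbours. -/
theorem NoTwoSep.exists_att (h : NoTwoSep H) {K : Set V} {x u : V} (hx : x ∈ K) (hu : u ∉ K)
    (p q : V) (hxp : x ≠ p) (hxq : x ≠ q) (hup : u ≠ p) (huq : u ≠ q) :
    ∃ t, t ∉ K ∧ t ≠ p ∧ t ≠ q ∧ Att H K t := by
  by_contra hno
  push Not at hno
  refine hu ((h.reach p q x u hxp hxq hup huq).mem_of_closed hx fun a ha b hb hab => ?_)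
  by_contra hbK
  simp only [Set.mem_compl_iff, Set.mem_insert_iff, Set.mem_singleton_iff, not_or] at hb
  exact hno b hbK hb.1 hb.2 ⟨a, ha, hab⟩

/-- A node of a chordless cycle has a neighbour off the cycle. -/
theorem NoTwoSep.exists_adj_off_hole (h : NoTwoSep H) {c : ℕ → V} {n : ℕ} (hc : IsHole G c n)
    {i : ℕ} (hi : i ≤ n) (hGH : ∀ x, H.Adj (c i) x → G.Adj (c i) x) :
    ∃ x, (∀ j ≤ n, c j ≠ x) ∧ G.Adj x (c i) := by
  obtain ⟨p, q, ⟨j, hj, hjp, hji⟩, ⟨k, hk, hkq, hki⟩, hpq⟩ := hc.exists_pair hi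
  obtain ⟨u, hup, huq, hu⟩ := h.exists_ne p q (c i)
  have hip : c i ≠ p := fun h => hji (hc.inj _ hj _ hi (hjp.trans h.symm))
  have hiq : c i ≠ q := fun h => hki (hc.inj _ hk _ hi (hkq.trans h.symm))
  -- Deleting the two cycle neighbours `p`, `q` of `c i` cannot isolate it.
  obtain ⟨t, ht, htp, htq, x, hx, hxt⟩ := h.exists_att (K := {c i}) rfl hu p q hip hiq hup huq
  obtain rfl : x = c i := hx
  refine ⟨t, ?_, (hGH t hxt).symm⟩
  rintro j hj rfl
  exact (hpq j hj (hGH _ hxt)).elim htp htq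

theorem reachIn_getVert {u v : V} (p : G.Walk u v) {i j : ℕ} (hij : i ≤ j) (hj : j ≤ p.length) :
    ReachIn G (p.getVert '' Set.Icc i j) (p.getVert i) (p.getVert j) :=
  ConnSet.image_Icc (c := p.getVert) (fun _ _ ht => p.adj_getVert_succ (by omega)) _ ⟨i, ⟨le_rfl, hij⟩, rfl⟩ _
    ⟨j, ⟨hij, le_rfl⟩, rfl⟩

/-- A maximal connected set `B` that leaves the ends of the link `vw` connected off the link
is the complement of a chordless cycle through the link. -/
theorem exists_hole_compl_connSet [Finite V] (h3 : NoTwoSep H) {v w : V} (hvw : H.Adj v w)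
    {B₀ : Set V} (hne : B₀.Nonempty) (hB₀ : ConnSet H B₀) (hv : v ∉ B₀) (hw : w ∉ B₀)
    (hr : ReachIn (H.deleteEdges {s(v, w)}) B₀ᶜ v w) :
    ∃ B, B₀ ⊆ B ∧ ConnSet H B ∧ ∃ P : (H.deleteEdges {s(v, w)}).Walk v w, P.IsPath ∧
      IsHole H P.getVert P.length ∧ ∀ x, x ∈ P.support ↔ x ∉ B := by
  set E := H.deleteEdges {s(v, w)} with hE
  have hEadj : ∀ a b, E.Adj a b ↔ H.Adj a b ∧ s(a, b) ≠ s(v, w) := fun a b => by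
    simp [hE, SimpleGraph.deleteEdges_adj]
  let F : Set (Set V) := {B | B₀ ⊆ B ∧ ConnSet H B ∧ v ∉ B ∧ w ∉ B ∧ ReachIn E Bᶜ v w}
  obtain ⟨B, ⟨hBB, hB, hvB, hwB, hrB⟩, hmax⟩ := (Set.toFinite F).exists_maximal
    ⟨B₀, subset_rfl, hB₀, hv, hw, hr⟩
  obtain ⟨u, hu⟩ := hne.mono hBB
  -- A further node attached to `B` could be absorbed unless it cuts `v` from `w`; hence every path
  -- from `v` to `w` off `B` passes through all such nodes.
  have hcut : ∀ x, x ∉ B → x ≠ v → x ≠ w → Att H B x → ¬ ReachIn E (Bᶜ \ {x}) v w := by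
    intro x hx hxv hxw hatt hr'
    have hle := hmax (y := insert x B) ⟨hBB.trans (Set.subset_insert _ _), hB.insert hatt,
      fun h => h.elim (fun h => hxv h.symm) hvB, fun h => h.elim (fun h => hxw h.symm) hwB,
      hr'.mono fun z hz h => h.elim hz.2 hz.1⟩ (Set.subset_insert x B)
    exact hx (hle (.inl rfl))
  obtain ⟨⟨P, hP⟩, hPB⟩ := hrB.exists_path
  dsimp only at hPB
  have hinj : ∀ i ≤ P.length, ∀ j ≤ P.length, P.getVert i = P.getVert j → i = j :=
    fun i hi j hj h => hP.getVert_injOn hi hj h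
  have hcB : ∀ i, P.getVert i ∉ B := fun i => hPB _ (P.getVert_mem_support i)
  have hseg : ∀ i j k, i ≤ j → j ≤ P.length → k ≤ P.length → (k < i ∨ j < k) →
      ReachIn E (Bᶜ \ {P.getVert k}) (P.getVert i) (P.getVert j) := by
    intro i j k hij hj hk hkij
    refine (reachIn_getVert P hij hj).mono ?_
    rintro _ ⟨t, ht, rfl⟩
    refine ⟨hcB t, fun h => ?_⟩
    have h1 := ht.1
    have h2 := ht.2
    have := hinj t (by omega) k hk h
    omega
  have hv0 : P.getVert 0 = v := P.getVert_zero
  have hwn : P.getVert P.length = w := P.getVert_length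
  have honP : ∀ x, x ∉ B → (x = v ∨ x = w ∨ Att H B x) → ∃ i ≤ P.length, P.getVert i = x := by
    intro x hx hatt
    by_cases hxv : x = v
    · exact ⟨0, by omega, hv0.trans hxv.symm⟩
    by_cases hxw : x = w
    · exact ⟨P.length, le_rfl, hwn.trans hxw.symm⟩
    by_contra hno
    refine hcut x hx hxv hxw ((hatt.resolve_left hxv).resolve_left hxw) ⟨P, fun z hz => ?_⟩
    refine ⟨hPB z hz, fun h => hno ?_⟩
    obtain rfl : z = x := h
    obtain ⟨i, hi, hil⟩ := Walk.mem_support_iff_exists_getVert.1 hz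
    exact ⟨i, hil, hi⟩
  -- every node outside `B` other than `v`, `w` is adjacent to `B`
  have hatt : ∀ x, x ∉ B → x ≠ v → x ≠ w → Att H B x := by
    intro x hx hxv hxw
    by_contra hxatt
    let Q : Set V := {y | y ∉ B ∧ y ≠ v ∧ y ≠ w ∧ ¬ Att H B y}
    -- A component of unattached nodes has its neighbours on `P`, at least three by 3-connectivity.
    -- The detour through `K` from the first to the last one bypasses a middle one, which is
    -- attached to `B` and so should be a cut node.
    let K : Set V := {z | ReachIn H Q x z}
    have hKQ : K ⊆ Q := fun z (hz : ReachIn _ _ _ _) => hz.right_mem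
    have hxK : x ∈ K := ReachIn.refl ⟨hx, hxv, hxw, hxatt⟩
    have huK : u ∉ K := fun h => (hKQ h).1 hu
    have hKconn : ConnSet H K := .reach x
    have hNK : ∀ t, t ∉ K → Att H K t → ∃ i ≤ P.length, P.getVert i = t := by
      rintro t ht ⟨a, ha, hat⟩
      have htB : t ∉ B := fun h => (hKQ ha).2.2.2 ⟨t, h, hat.symm⟩
      refine honP t htB ?_
      by_contra hno
      push Not at hno
      exact ht (ReachIn.trans ha (.of_adj hat (hKQ ha) ⟨htB, hno⟩))
    let I : Set ℕ := {i | i ≤ P.length ∧ P.getVert i ∉ K ∧ Att H K (P.getVert i)}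
    have hIfin : I.Finite := (Set.finite_Iic P.length).subset fun i hi => hi.1
    have hIne : I.Nonempty := by
      obtain ⟨t, htK, -, -, hta⟩ := h3.exists_att hxK huK v v hxv hxv
        (fun h => hvB (h ▸ hu)) (fun h => hvB (h ▸ hu))
      obtain ⟨i, hi, rfl⟩ := hNK t htK hta
      exact ⟨i, hi, htK, hta⟩
    obtain ⟨i, hiI, hi⟩ := Set.exists_min_image I id hIfin hIne
    obtain ⟨j, hjI, hj⟩ := Set.exists_max_image I id hIfin hIne
    obtain ⟨t, htK, hti, htj, hta⟩ := h3.exists_att hxK huK (P.getVert i) (P.getVert j)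
      (fun h => hiI.2.1 (h ▸ hxK)) (fun h => hjI.2.1 (h ▸ hxK))
      (fun h => hcB i (h ▸ hu)) (fun h => hcB j (h ▸ hu))
    obtain ⟨k, hk, rfl⟩ := hNK t htK hta
    have hkI : k ∈ I := ⟨hk, htK, hta⟩
    have hik : i < k := lt_of_le_of_ne (hi k hkI) fun h => hti (by rw [h])
    have hkj : k < j := lt_of_le_of_ne (hj k hkI) fun h => htj (by rw [h])
    have hjl := hjI.1
    obtain ⟨a, haK, hai⟩ := hiI.2.2
    obtain ⟨b, hbK, hbj⟩ := hjI.2.2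
    have hKsub : ∀ z ∈ K, z ∈ Bᶜ \ {P.getVert k} := fun z hz =>
      ⟨(hKQ hz).1, fun h => htK (by rw [Set.mem_singleton_iff] at h; exact h ▸ hz)⟩
    have hKE : ∀ z ∈ K, ∀ y, H.Adj z y → E.Adj z y := by
      intro z hz y hzy
      refine (hEadj z y).2 ⟨hzy, fun h => ?_⟩
      rcases Sym2.eq_iff.1 h with ⟨h, -⟩ | ⟨h, -⟩
      · exact (hKQ hz).2.1 h
      · exact (hKQ hz).2.2.1 h
    have hab : ReachIn E K a b :=
      (hKconn a haK b hbK).map_adj fun z hz y _ h => hKE z hz y h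
    refine hcut (P.getVert k) (hcB k) (fun h => ?_) (fun h => ?_) ?_ ?_
    · have := hinj k hk 0 (by omega) (h.trans hv0.symm)
      omega
    · have := hinj k hk _ le_rfl (h.trans hwn.symm)
      omega
    · by_contra hno
      have h1 : P.getVert k ≠ v := fun h => by
        have := hinj k hk 0 (by omega) (h.trans hv0.symm)
        omega
      have h2 : P.getVert k ≠ w := fun h => by
        have := hinj k hk _ le_rfl (h.trans hwn.symm)
        omega
      obtain ⟨z, hz, hzk⟩ := hta
      exact htK (ReachIn.trans hz (.of_adj hzk (hKQ hz) ⟨hcB k, h1, h2, hno⟩))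
    · have s1 := hseg 0 i k (by omega) (by omega) hk (by omega)
      have s2 := hseg j P.length k (by omega) le_rfl hk (by omega)
      rw [hv0] at s1
      rw [hwn] at s2
      refine s1.trans (.trans (.of_adj (hKE a haK _ hai).symm s1.right_mem (hKsub a haK)) ?_)
      refine (hab.mono hKsub).trans (.trans ?_ s2)
      exact .of_adj (hKE b hbK _ hbj) (hKsub b hbK) s2.left_mem
  have hlen : 2 ≤ P.length := by
    by_contra hlt
    have h01 : P.length ≠ 0 := fun h => by
      rw [h] at hwn
      exact hvw.ne (hv0.symm.trans hwn)
    have := P.adj_getVert_succ (i := 0) (by omega)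
    rw [hv0, show 0 + 1 = P.length by omega, hwn, hEadj] at this
    exact this.2 rfl
  refine ⟨B, hBB, hB, P, hP, ⟨hlen, hinj, fun i hi => ((hEadj _ _).1 (P.adj_getVert_succ hi)).1,
    ?_, ?_⟩, fun x => ⟨hPB x, fun hx => ?_⟩⟩
  · rw [hv0, hwn]
    exact hvw.symm
  -- A chord from index `i` would bypass the cut node `P.getVert (i + 1)`.
  · intro i j hij hj hadj
    by_contra hno
    push Not at hno
    have hEij : E.Adj (P.getVert i) (P.getVert j) := by
      refine (hEadj _ _).2 ⟨hadj, fun h => ?_⟩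
      rcases Sym2.eq_iff.1 h with ⟨h, h'⟩ | ⟨h, h'⟩
      · have h1 := hinj i (by omega) 0 (by omega) (h.trans hv0.symm)
        have h2 := hinj j (by omega) _ le_rfl (h'.trans hwn.symm)
        exact hno.2 h1 h2
      · have h2 := hinj j (by omega) 0 (by omega) (h'.trans hv0.symm)
        omega
    have hne1 : j ≠ i + 1 := hno.1
    have s1 := hseg 0 i (i + 1) (by omega) (by omega) (by omega) (by omega)
    have s2 := hseg j P.length (i + 1) (by omega) le_rfl (by omega) (by omega)
    rw [hv0] at s1
    rw [hwn] at s2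
    have h1 : P.getVert (i + 1) ≠ v := fun h => by
      have := hinj (i + 1) (by omega) 0 (by omega) (h.trans hv0.symm)
      omega
    have h2 : P.getVert (i + 1) ≠ w := fun h => by
      have := hinj (i + 1) (by omega) _ le_rfl (h.trans hwn.symm)
      omega
    exact hcut _ (hcB _) h1 h2 (hatt _ (hcB _) h1 h2)
      (s1.trans (.trans (.of_adj hEij s1.right_mem s2.left_mem) s2))
  · have : x = v ∨ x = w ∨ Att H B x := by
      by_contra hno
      push Not at hno
      exact hno.2.2 (hatt x hx hno.1 hno.2.1)
    obtain ⟨i, hi, rfl⟩ := honP x hx this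
    exact P.getVert_mem_support i

end ThreeConnected

/-! ### Faces of `G` and chordless cycles of `G + m₁m₂` -/

section Faces

variable {V : Type*} {G : SimpleGraph V} {m₁ m₂ : V}

theorem sup_edge_adj {x y : V} : (G ⊔ edge m₁ m₂).Adj x y ↔
    G.Adj x y ∨ (((x = m₁ ∧ y = m₂) ∨ (x = m₂ ∧ y = m₁)) ∧ x ≠ y) := by
  simp [edge_adj]

/-- A walk that may use the link between the monitors contains a walk to a monitor that
does not. -/
theorem ReachIn.exists_monitor {S : Set V} {x m : V}
    (h : ReachIn (G ⊔ edge m₁ m₂) S x m) (hm : m = m₁ ∨ m = m₂) :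
    ReachIn G S x m₁ ∨ ReachIn G S x m₂ := by
  -- Stopped at its first monitor, the walk holds only one monitor and cannot use the link between
  -- them.
  obtain ⟨t, ht, htS, hr⟩ := h.exists_first (T := {m₁, m₂}) (by simpa using hm)
  have hr' : ReachIn G S x t := by
    refine (hr.map_adj (H := G) fun u hu v hv huv => ?_).mono ?_
    · rcases sup_edge_adj.1 huv with h | ⟨h, hne⟩
      · exact h
      · have key : ∀ z ∈ insert t (S \ {m₁, m₂}), (z = m₁ ∨ z = m₂) → z = t := by
          rintro z (rfl | hz) hz'
          · rfl
          · exact absurd hz' (by simpa using hz.2)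
        exact absurd ((key u hu (by tauto)).trans (key v hv (by tauto)).symm) hne
    · rintro u (rfl | hu)
      exacts [htS, hu.1]
  rcases ht with rfl | rfl
  exacts [.inl hr', .inr hr']

/-- The two forms of the condition on the complement of a face. -/
theorem exists_monitor_iff (S : Set V) :
    (∀ K : (G.induce S).ConnectedComponent, ∃ x ∈ K.supp, (x : V) = m₁ ∨ (x : V) = m₂) ↔
      ∀ r ∈ S, ReachIn G S r m₁ ∨ ReachIn G S r m₂ := by
  constructor
  · intro h r hr
    obtain ⟨x, hx, hxm⟩ := h ((G.induce S).connectedComponentMk ⟨r, hr⟩)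
    have hreach : ReachIn G S r x := ReachIn.of_induce
      (ConnectedComponent.exact ((ConnectedComponent.mem_supp_iff _ _).1 hx)).symm
    rcases hxm with h | h
    · exact .inl (h ▸ hreach)
    · exact .inr (h ▸ hreach)
  · intro h K
    induction K using ConnectedComponent.ind with
    | h r =>
      have key : ∀ m, ReachIn G S r m →
          ∃ x ∈ ((G.induce S).connectedComponentMk r).supp, (x : V) = m := by
        rintro m ⟨p, hp⟩
        refine ⟨⟨m, hp _ p.end_mem_support⟩, ?_, rfl⟩
        rw [ConnectedComponent.mem_supp_iff]
        exact (ConnectedComponent.sound ⟨p.induce S hp⟩).symm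
      rcases h r r.2 with h | h
      · obtain ⟨x, hx, hxm⟩ := key _ h
        exact ⟨x, hx, .inl hxm⟩
      · obtain ⟨x, hx, hxm⟩ := key _ h
        exact ⟨x, hx, .inr hxm⟩

/-- A path between the ends of a link, together with the link, is a cycle. -/
theorem isCycleSubgraph_cons {v w : V} (p : G.Walk v w) (hp : p.IsPath) (h : G.Adj w v)
    (hnot : s(w, v) ∉ p.edges) :
    ∃ C : G.Subgraph, IsCycleSubgraph C ∧ s(v, w) ∈ C.edgeSet ∧ (∀ x, x ∈ C.verts ↔ x ∈ p.support) ∧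
      ∀ e, e ∈ C.edgeSet ↔ e = s(v, w) ∨ e ∈ p.edges := by
  have hedge : ∀ e, e ∈ (Walk.cons h p).toSubgraph.edgeSet ↔ e = s(v, w) ∨ e ∈ p.edges := by
    intro e
    rw [Walk.mem_edges_toSubgraph, Walk.edges_cons, List.mem_cons, Sym2.eq_swap]
  refine ⟨(Walk.cons h p).toSubgraph,
    ⟨w, Walk.cons h p, (Walk.cons_isCycle_iff p h).2 ⟨hp, hnot⟩, rfl⟩,
    (hedge _).2 (.inl rfl), fun x => ?_, hedge⟩
  rw [Walk.mem_verts_toSubgraph, Walk.support_cons, List.mem_cons]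
  constructor
  · rintro (rfl | hx)
    exacts [p.end_mem_support, hx]
  · exact .inr

/-- The maximal set grown from `B₀` contains the monitor `m`, so its complementary cycle cannot use
the link `m₁m₂` and is a cycle of `G`. Connectedness of the set in `G + m₁m₂` lets each of its nodes
reach a monitor in `G`. -/
theorem exists_face_disjoint [Finite V] (hnadj : ¬ G.Adj m₁ m₂)
    (h3 : NoTwoSep (G ⊔ edge m₁ m₂)) {v w m : V} (hvw : G.Adj v w) {B₀ : Set V}
    (hm : m ∈ B₀) (hmm : m = m₁ ∨ m = m₂) (hB₀ : ConnSet (G ⊔ edge m₁ m₂) B₀) (hv : v ∉ B₀)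
    (hw : w ∉ B₀) (hr : ReachIn ((G ⊔ edge m₁ m₂).deleteEdges {s(v, w)}) B₀ᶜ v w) :
    ∃ C : G.Subgraph, IsFace m₁ m₂ C ∧ s(v, w) ∈ C.edgeSet ∧ Disjoint C.verts B₀ := by
  obtain ⟨B, hBB, hB, P, hP, hhole, hsupp⟩ := exists_hole_compl_connSet h3 (.inl hvw)
    ⟨m, hm⟩ hB₀ hv hw hr
  have hmP : m ∉ P.support := fun h => (hsupp m).1 h (hBB hm)
  have hadjG : ∀ x y, x ∈ P.support → y ∈ P.support → (G ⊔ edge m₁ m₂).Adj x y → G.Adj x y := by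
    intro x y hx hy hxy
    rcases sup_edge_adj.1 hxy with h | ⟨h, -⟩
    · exact h
    · have h1 : x ≠ m := fun h => hmP (h ▸ hx)
      have h2 : y ≠ m := fun h => hmP (h ▸ hy)
      rcases hmm with rfl | rfl <;> rcases h with ⟨rfl, rfl⟩ | ⟨rfl, rfl⟩ <;> simp_all
  have hPe : ∀ e ∈ P.edges, e ∈ G.edgeSet := by
    intro e he
    induction e with | h x y
    refine hadjG x y (P.fst_mem_support_of_mem_edges he) (P.snd_mem_support_of_mem_edges he) ?_
    have := P.adj_of_mem_edges he
    rw [deleteEdges_adj] at this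
    exact this.1
  have hPnot : s(w, v) ∉ P.edges := by
    intro he
    have := P.adj_of_mem_edges he
    rw [deleteEdges_adj] at this
    exact this.2 Sym2.eq_swap
  obtain ⟨C, hC, hCe, hCv, hCE⟩ := isCycleSubgraph_cons (P.transfer G hPe) (hP.transfer hPe)
    hvw.symm (by rwa [Walk.edges_transfer])
  simp only [Walk.support_transfer, Walk.edges_transfer] at hCv hCE
  have hCB : C.verts = Bᶜ := Set.ext fun x => (hCv x).trans (hsupp x)
  refine ⟨C, ⟨hC, ?_, ?_⟩, hCe, ?_⟩
  · intro x hx y hy hxy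
    rw [← Subgraph.mem_edgeSet, hCE]
    obtain ⟨i, rfl, hi⟩ := Walk.mem_support_iff_exists_getVert.1 ((hCv x).1 hx)
    obtain ⟨j, rfl, hj⟩ := Walk.mem_support_iff_exists_getVert.1 ((hCv y).1 hy)
    have key : ∀ i j, i < j → j ≤ P.length → G.Adj (P.getVert i) (P.getVert j) →
        s(P.getVert i, P.getVert j) = s(v, w) ∨ s(P.getVert i, P.getVert j) ∈ P.edges := by
      intro i j hij hj hadj
      rcases hhole.chord i j hij hj (.inl hadj) with rfl | ⟨rfl, rfl⟩
      · right
        rw [Walk.mk_mem_edges_iff_exists]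
        exact ⟨i, by omega, rfl⟩
      · left
        rw [P.getVert_zero, P.getVert_length]
    rcases lt_trichotomy i j with hij | rfl | hij
    · exact key i j hij hj hxy
    · exact absurd rfl hxy.ne
    · rw [Sym2.eq_swap]
      exact key j i hij hi hxy.symm
  · rw [hCB, compl_compl, exists_monitor_iff]
    exact fun r hr => (hB r hr m (hBB hm)).exists_monitor hmm
  · rw [hCB]
    exact Set.disjoint_left.2 fun x hx hx' => hx (hBB hx')

/-- Every link of a cycle can be taken as the closing link of a path. -/
theorem IsCycleSubgraph.exists_path {C : G.Subgraph} (hC : IsCycleSubgraph C) {v w : V}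
    (he : s(v, w) ∈ C.edgeSet) :
    ∃ p : G.Walk v w, p.IsPath ∧ s(v, w) ∉ p.edges ∧ (∀ x, x ∈ C.verts ↔ x ∈ p.support) ∧
      ∀ e, e ∈ C.edgeSet ↔ e = s(v, w) ∨ e ∈ p.edges := by
  classical
  obtain ⟨u, p, hp, rfl⟩ := hC
  have key : ∀ (p' : G.Walk v v), p'.IsCycle → p'.snd = w → ∃ q : G.Walk v w, q.IsPath ∧
      s(v, w) ∉ q.edges ∧ (∀ x, x ∈ p'.toSubgraph.verts ↔ x ∈ q.support) ∧
      ∀ e, e ∈ p'.toSubgraph.edgeSet ↔ e = s(v, w) ∨ e ∈ q.edges := by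
    intro p' hp' hsnd
    cases p' with
    | nil => exact absurd hp' Walk.not_isCycle_nil
    | @cons _ x _ h q =>
      obtain rfl : x = w := by simpa using hsnd
      obtain ⟨hq, hnot⟩ := (Walk.cons_isCycle_iff q h).1 hp'
      refine ⟨q.reverse, hq.reverse, by simpa using hnot, fun z => ?_, fun e => ?_⟩
      · rw [Walk.mem_verts_toSubgraph, Walk.support_cons, List.mem_cons, Walk.support_reverse,
          List.mem_reverse]
        exact ⟨fun hz => hz.elim (fun hz => hz ▸ q.end_mem_support) id, .inr⟩
      · rw [Walk.mem_edges_toSubgraph, Walk.edges_cons, List.mem_cons, Walk.edges_reverse,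
          List.mem_reverse]
  have hv : v ∈ p.support := by
    rw [Walk.mem_edges_toSubgraph] at he
    exact p.fst_mem_support_of_mem_edges he
  have hp' := hp.rotate hv
  rw [← p.toSubgraph_rotate hv] at he ⊢
  set p' := p.rotate v hv
  cases hpp : p' with
  | nil => rw [hpp] at hp'; exact absurd hp' Walk.not_isCycle_nil
  | @cons _ x _ h q =>
    rw [hpp] at he hp'
    by_cases hx : x = w
    · exact key _ hp' (by simpa using hx)
    · have hq := ((Walk.cons_isCycle_iff q h).1 hp').1
      rw [Walk.mem_edges_toSubgraph, Walk.edges_cons, List.mem_cons] at he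
      have heq : s(v, w) ∈ q.edges := by
        refine he.resolve_left fun h' => ?_
        rcases Sym2.eq_iff.1 h' with ⟨-, h'⟩ | ⟨h', -⟩
        · exact hx h'.symm
        · exact h.ne h'
      -- If `w` does not follow `v` on the cycle, it precedes it, and the reversed cycle serves.
      have hw := hq.eq_penultimate_of_mem_edges heq
      have := key _ hp'.reverse (by
        rw [Walk.snd_reverse, Walk.penultimate_cons_of_not_nil]
        · exact hw.symm
        · intro hnil
          rw [Walk.edges_eq_nil.2 hnil] at heq
          simp at heq)
      rwa [Walk.toSubgraph_reverse] at this

/-- A face with a distinguished link, as a chordless cycle. -/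
theorem IsFace.exists_hole {C : G.Subgraph} (hC : IsFace m₁ m₂ C) {v w : V}
    (he : s(v, w) ∈ C.edgeSet) :
    ∃ (c : ℕ → V) (n : ℕ), IsHole G c n ∧ c 0 = v ∧ c n = w ∧
      (∀ x, x ∈ C.verts ↔ ∃ i ≤ n, c i = x) ∧
      ∀ e ∈ C.edgeSet, e = s(v, w) ∨ ∃ k < n, e = s(c k, c (k + 1)) := by
  obtain ⟨p, hp, hnot, hv, hE⟩ := hC.isCycle.exists_path he
  have hvw : G.Adj v w := C.adj_sub he
  have hverts : ∀ x, x ∈ C.verts ↔ ∃ i ≤ p.length, p.getVert i = x := fun x => by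
    rw [hv, Walk.mem_support_iff_exists_getVert]
    exact ⟨fun ⟨i, h, h'⟩ => ⟨i, h', h⟩, fun ⟨i, h, h'⟩ => ⟨i, h', h⟩⟩
  have hedges : ∀ e ∈ C.edgeSet, e = s(v, w) ∨
      ∃ k < p.length, e = s(p.getVert k, p.getVert (k + 1)) := by
    intro e he'
    refine ((hE e).1 he').imp_right fun h => ?_
    induction e with | h x y
    rw [Walk.mk_mem_edges_iff_exists] at h
    obtain ⟨k, hk, h⟩ := h
    exact ⟨k, by omega, h.symm⟩
  have hinj : ∀ i ≤ p.length, ∀ j ≤ p.length, p.getVert i = p.getVert j → i = j :=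
    fun i hi j hj h => hp.getVert_injOn hi hj h
  have hv0 : p.getVert 0 = v := p.getVert_zero
  have hwn : p.getVert p.length = w := p.getVert_length
  refine ⟨p.getVert, p.length, ⟨?_, hinj, fun i hi => p.adj_getVert_succ hi, ?_, ?_⟩,
    hv0, hwn, hverts, hedges⟩
  · by_contra hlt
    have h0 : p.length ≠ 0 := fun h => by
      rw [h] at hwn
      exact hvw.ne (hv0.symm.trans hwn)
    refine hnot ((Walk.mk_mem_edges_iff_exists p).2 ⟨0, by omega, ?_⟩)
    rw [hv0, show 0 + 1 = p.length by omega, hwn]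
  · rw [hv0, hwn]
    exact hvw.symm
  · intro i j hij hj hadj
    have hmem : s(p.getVert i, p.getVert j) ∈ C.edgeSet :=
      hC.isInduced ((hverts _).2 ⟨i, by omega, rfl⟩) ((hverts _).2 ⟨j, hj, rfl⟩) hadj
    rcases hedges _ hmem with h | ⟨k, hk, h⟩
    · rcases Sym2.eq_iff.1 h with ⟨h, h'⟩ | ⟨h, h'⟩
      · exact .inr ⟨hinj i (by omega) 0 (by omega) (h.trans hv0.symm),
          hinj j hj _ le_rfl (h'.trans hwn.symm)⟩
      · have := hinj j hj 0 (by omega) (h'.trans hv0.symm)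
        omega
    · rcases Sym2.eq_iff.1 h with ⟨h, h'⟩ | ⟨h, h'⟩
      · have h1 := hinj i (by omega) k (by omega) h
        have h2 := hinj j hj (k + 1) (by omega) h'
        omega
      · have h1 := hinj i (by omega) (k + 1) (by omega) h
        have h2 := hinj j hj k (by omega) h'
        omega

theorem IsFace.reach_monitor {C : G.Subgraph} (hC : IsFace m₁ m₂ C) :
    ∀ r ∈ C.vertsᶜ, ReachIn G C.vertsᶜ r m₁ ∨ ReachIn G C.vertsᶜ r m₂ :=
  (exists_monitor_iff _).1 hC.exists_monitor

end Faces

/-! ### Splits, Type 1 links, and faces through a monitor -/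

section Split

variable {V : Type*} {G : SimpleGraph V} {m₁ m₂ v w : V}

/-- Disjoint connected sets around the two monitors that avoid `v` and `w` and are both adjacent
to each of them. -/
def Split (G : SimpleGraph V) (m₁ m₂ v w : V) : Prop :=
  ∃ X Y : Set V, ConnSet G X ∧ ConnSet G Y ∧ Disjoint X Y ∧ m₁ ∈ X ∧ m₂ ∈ Y ∧
    X ⊆ {v, w}ᶜ ∧ Y ⊆ {v, w}ᶜ ∧ (Att G X v ∧ Att G X w) ∧ Att G Y v ∧ Att G Y w

theorem Split.swap (h : Split G m₁ m₂ v w) : Split G m₂ m₁ v w := by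
  obtain ⟨X, Y, hX, hY, hXY, h1, h2, h3, h4, h5, h6⟩ := h
  exact ⟨Y, X, hY, hX, hXY.symm, h2, h1, h4, h3, h6, h5⟩

theorem Split.swap_ends (h : Split G m₁ m₂ v w) : Split G m₁ m₂ w v := by
  obtain ⟨X, Y, hX, hY, hXY, h1, h2, h3, h4, h5, h6⟩ := h
  rw [Set.pair_comm] at h3 h4
  exact ⟨X, Y, hX, hY, hXY, h1, h2, h3, h4, h5.symm, h6.symm⟩

/-- Once the two sets are enlarged to a partition of all nodes but `v`, `w`, a face avoiding `Y`
lies in `X ∪ {v, w}`. The second cycle runs through `Y`, and each path stays in the part of its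
monitor. -/
theorem Split.isTypeOneLink [Finite V] (hnadj : ¬ G.Adj m₁ m₂) (h3 : NoTwoSep (G ⊔ edge m₁ m₂))
    (hvw : G.Adj v w) (h : Split G m₁ m₂ v w) : IsTypeOneLink G m₁ m₂ s(v, w) := by
  obtain ⟨X₀, Y₀, hX₀, hY₀, hXY₀, hm₁, hm₂, hX₀S, hY₀S, hattX, hattY⟩ := h
  have hm₁S := hX₀S hm₁
  simp only [Set.mem_compl_iff, Set.mem_insert_iff, Set.mem_singleton_iff, not_or] at hm₁S
  obtain ⟨X, Y, hX₀X, hY₀Y, hX, hY, hXY, hunion⟩ := exists_partition G (R := {v, w}ᶜ)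
    (fun r hr => by
      simp only [Set.mem_compl_iff, Set.mem_insert_iff, Set.mem_singleton_iff, not_or] at hr
      exact (h3.reach v w r m₁ hr.1 hr.2 hm₁S.1 hm₁S.2).exists_monitor (.inl rfl))
    hX₀ hY₀ hXY₀ hm₁ hm₂ hX₀S hY₀S
  replace hm₁ := hX₀X hm₁
  replace hm₂ := hY₀Y hm₂
  obtain ⟨⟨x₁, hx₁, hx₁v⟩, ⟨x₂, hx₂, hx₂w⟩⟩ := And.imp (·.mono hX₀X) (·.mono hX₀X) hattX
  obtain ⟨⟨y₁, hy₁, hy₁v⟩, ⟨y₂, hy₂, hy₂w⟩⟩ := And.imp (·.mono hY₀Y) (·.mono hY₀Y) hattY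
  have hXne : ∀ x ∈ X, x ≠ v ∧ x ≠ w := fun x hx => by
    simpa using hunion.subset (.inl hx)
  have hYne : ∀ x ∈ Y, x ≠ v ∧ x ≠ w := fun x hx => by
    simpa using hunion.subset (.inr hx)
  have hvY : v ∉ Y := fun h => (hYne v h).1 rfl
  have hwY : w ∉ Y := fun h => (hYne w h).2 rfl
  have hXY' : ∀ x ∈ X, x ∉ Y := fun x hx hx' => Set.disjoint_left.1 hXY hx hx'
  have hE : ∀ x ∈ X, ∀ y, G.Adj x y → ((G ⊔ edge m₁ m₂).deleteEdges {s(v, w)}).Adj x y := by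
    intro x hx y hxy
    rw [deleteEdges_adj]
    refine ⟨.inl hxy, fun h => ?_⟩
    rcases Sym2.eq_iff.1 h with ⟨h, -⟩ | ⟨h, -⟩
    exacts [(hXne x hx).1 h, (hXne x hx).2 h]
  obtain ⟨C, hC, hCe, hCY⟩ := exists_face_disjoint hnadj h3 hvw hm₂ (.inr rfl)
    (hY.map_adj fun _ _ _ _ h => .inl h) hvY hwY <| by
      refine ReachIn.trans (.of_adj (hE x₁ hx₁ v hx₁v).symm hvY (hXY' _ hx₁))
        (.trans (((hX x₁ hx₁ x₂ hx₂).map_adj fun u hu v' _ h => hE u hu v' h).mono hXY')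
        (.of_adj (hE x₂ hx₂ w hx₂w) (hXY' _ hx₂) hwY))
  have hCY' : ∀ x ∈ C.verts, x ∉ Y := fun x hx hx' => Set.disjoint_left.1 hCY hx hx'
  have hvC : v ∈ C.verts := C.edge_vert hCe
  have hwC : w ∈ C.verts := C.edge_vert (Subgraph.Adj.symm hCe)
  obtain ⟨c, n, hc, hc0, hcn, hcv, -⟩ := hC.exists_hole hCe
  have h2n := hc.two_le
  have hc1C : c 1 ∈ C.verts := (hcv _).2 ⟨1, by omega, rfl⟩
  -- As `2 ≤ n`, the node `c 1` of the face is neither `v` nor `w`; it gives `m₁` a target inside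
  -- `X`.
  have hc1 : c 1 ∈ X := by
    have : c 1 ∈ X ∪ Y := by
      rw [hunion]
      rintro (h | h)
      · have := hc.inj 1 (by omega) 0 (by omega) (h.trans hc0.symm)
        omega
      · have := hc.inj 1 (by omega) n le_rfl (Eq.trans h hcn.symm)
        omega
    exact this.resolve_right (hCY' _ hc1C)
  obtain ⟨x, hxC, P₁, hP₁X, hP₁C⟩ := (hX m₁ hm₁ _ hc1).exists_path_first hc1C
  obtain ⟨⟨q, hq⟩, hqY⟩ := (hY y₁ hy₁ y₂ hy₂).exists_path
  dsimp only at hqY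
  have hvq : v ∉ q.support := fun h => hvY (hqY v h)
  have hwq : w ∉ q.support := fun h => hwY (hqY w h)
  obtain ⟨C₂, hC₂, hC₂e, hC₂v, -⟩ := isCycleSubgraph_cons
    (Walk.cons hy₁v.symm (q.concat hy₂w))
    ((Walk.cons_isPath_iff _ _).2 ⟨hq.concat hwq _, by
      rw [Walk.support_concat]
      simpa using ⟨hvq, hvw.ne⟩⟩) hvw.symm (by
      rw [Walk.edges_cons, Walk.edges_concat]
      simp only [List.concat_eq_append, List.mem_cons, List.mem_append, List.not_mem_nil, or_false,
        not_or]
      refine ⟨fun h => ?_, fun h => hwq (q.fst_mem_support_of_mem_edges h), fun h => ?_⟩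
      · rcases Sym2.eq_iff.1 h with ⟨h, -⟩ | ⟨h, -⟩
        exacts [hvw.ne h.symm, hwY (h ▸ hy₁)]
      · rcases Sym2.eq_iff.1 h with ⟨h, -⟩ | ⟨-, h⟩
        exacts [hwY (h ▸ hy₂), hvY (h ▸ hy₂)])
  have hC₂v' : ∀ z, z ∈ C₂.verts ↔ z = v ∨ z ∈ q.support ∨ z = w := fun z => by
    rw [hC₂v, Walk.support_cons, Walk.support_concat]
    simp
  have hC₂Y : ∀ z ∈ C₂.verts, z = v ∨ z = w ∨ z ∈ Y := fun z hz => by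
    rcases (hC₂v' z).1 hz with h | h | h
    exacts [.inl h, .inr (.inr (hqY z h)), .inr (.inl h)]
  obtain ⟨y, hyC, P₂, hP₂Y, hP₂C⟩ := (hY m₂ hm₂ _ hy₁).exists_path_first (T := C₂.verts)
    ((hC₂v' _).2 (.inr (.inl q.start_mem_support)))
  refine ⟨C, C₂, hC, hC₂, hCe, hC₂e, ?_, m₁, m₂, .inl ⟨rfl, rfl⟩, x, y, P₁, P₂,
    fun z hz hz' => hXY' z (hP₁X z hz) (hP₂Y z hz'), hxC, hP₁C, fun z hz hz' => ?_, hyC, hP₂C,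
    fun z hz hz' => hCY' z hz' (hP₂Y z hz)⟩
  · ext z
    simp only [Set.mem_inter_iff, Set.mem_ofPred_eq, Sym2.mem_iff]
    constructor
    · rintro ⟨hz, hz'⟩
      rcases hC₂Y z hz' with h | h | h
      exacts [.inl h, .inr h, absurd h (hCY' z hz)]
    · rintro (rfl | rfl)
      exacts [⟨hvC, (hC₂v' _).2 (.inl rfl)⟩, ⟨hwC, (hC₂v' _).2 (.inr (.inr rfl))⟩]
  · have hzX := hP₁X z hz
    rcases hC₂Y z hz' with h | h | h
    exacts [(hXne z hzX).1 h, (hXne z hzX).2 h, hXY' z hzX h]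

theorem mem_interiorGraph_iff : s(v, w) ∈ (interiorGraph G m₁ m₂).edgeSet ↔
    G.Adj v w ∧ (v ≠ m₁ ∧ v ≠ m₂) ∧ w ≠ m₁ ∧ w ≠ m₂ := by
  rw [Subgraph.mem_edgeSet, interiorGraph, Subgraph.deleteVerts_adj]
  simp
  tauto

/-- A stretch of a chordless cycle is connected. -/
theorem IsHole.connSet_inner {c : ℕ → V} {n : ℕ} (hc : IsHole G c n) {i j : ℕ} (hj : j ≤ n) :
    ConnSet G (c '' Set.Icc i j) :=
  .image_Icc fun t _ ht => hc.adj t (by omega)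

theorem IsHole.image_subset {c : ℕ → V} {n : ℕ} (hc : IsHole G c n) {i j : ℕ} (hi : 1 ≤ i)
    (hj : j < n) : c '' Set.Icc i j ⊆ {c 0, c n}ᶜ := by
  rintro _ ⟨t, ⟨ht1, ht2⟩, rfl⟩ (h | h)
  · have := hc.inj t (by omega) 0 (by omega) h
    omega
  · have := hc.inj t (by omega) n le_rfl h
    omega

theorem IsHole.att_inner_zero {c : ℕ → V} {n : ℕ} (hc : IsHole G c n) {j : ℕ} (hj : 1 ≤ j) :
    Att G (c '' Set.Icc 1 j) (c 0) :=
  ⟨c 1, ⟨1, ⟨le_rfl, hj⟩, rfl⟩, (hc.adj 0 (by have := hc.two_le; omega)).symm⟩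

theorem IsHole.att_inner_last {c : ℕ → V} {n : ℕ} (hc : IsHole G c n) {i : ℕ} (hi : i < n) :
    Att G (c '' Set.Icc i (n - 1)) (c n) := by
  refine ⟨c (n - 1), ⟨n - 1, ⟨by omega, le_rfl⟩, rfl⟩, ?_⟩
  have := hc.adj (n - 1) (by omega)
  rwa [Nat.sub_add_cancel (by omega)] at this

/-- A cycle with connected complement that contains one monitor splits its closing link. -/
theorem IsHole.split_of_mem {c : ℕ → V} {n : ℕ} (hc : IsHole G c n) {a b : V} {C : Set V}
    (hC : ∀ x, x ∈ C ↔ ∃ i ≤ n, c i = x) (hanch : ∀ r ∈ Cᶜ, ReachIn G Cᶜ r a ∨ ReachIn G Cᶜ r b)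
    (hv : Att G Cᶜ (c 0)) (hw : Att G Cᶜ (c n)) (hb : b ∈ C) (hb0 : b ≠ c 0) (hbn : b ≠ c n) :
    Split G a b (c 0) (c n) := by
  have h2 := hc.two_le
  have hanch' : ∀ r ∈ Cᶜ, ReachIn G Cᶜ r a := fun r hr =>
    (hanch r hr).resolve_right fun h => h.right_mem hb
  obtain ⟨r, hr, -⟩ := id hv
  have hsub : c '' Set.Icc 1 (n - 1) ⊆ C := by
    rintro _ ⟨t, ht, rfl⟩
    exact (hC _).2 ⟨t, by have := ht.2; omega, rfl⟩
  refine ⟨Cᶜ, c '' Set.Icc 1 (n - 1), fun x hx y hy => (hanch' x hx).trans (hanch' y hy).symm,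
    hc.connSet_inner (by omega), Set.disjoint_left.2 fun x hx hx' => hx (hsub hx'),
    (hanch' r hr).right_mem, ?_, ?_, hc.image_subset le_rfl (by omega), ⟨hv, hw⟩,
    hc.att_inner_zero (by omega), hc.att_inner_last (by omega)⟩
  · obtain ⟨i, hi, rfl⟩ := (hC b).1 hb
    have h0 : i ≠ 0 := fun h => hb0 (by rw [h])
    have hn : i ≠ n := fun h => hbn (by rw [h])
    exact ⟨i, ⟨by omega, by omega⟩, rfl⟩
  · rintro x hx (h | h)
    · exact hx ((hC x).2 ⟨0, by omega, h.symm⟩)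
    · exact hx ((hC x).2 ⟨n, le_rfl, Eq.symm h⟩)

theorem IsHole.att_compl {c : ℕ → V} {n : ℕ} (hc : IsHole G c n)
    (h3 : NoTwoSep (G ⊔ edge m₁ m₂)) {C : Set V} (hC : ∀ x, x ∈ C ↔ ∃ i ≤ n, c i = x)
    {i : ℕ} (hi : i ≤ n) (hx₁ : c i ≠ m₁) (hx₂ : c i ≠ m₂) : Att G Cᶜ (c i) := by
  obtain ⟨x, hx, hadj⟩ := h3.exists_adj_off_hole hc hi fun x hx => by
    rcases sup_edge_adj.1 hx with h | ⟨⟨h, -⟩ | ⟨h, -⟩, -⟩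
    exacts [h, absurd h hx₁, absurd h hx₂]
  exact ⟨x, fun h => by obtain ⟨j, hj, h⟩ := (hC x).1 h; exact hx j hj h, hadj⟩

/-- With one monitor on the face, every node off it reaches the other, so the complement is
connected. The complement and the rest of the cycle split the link; 3-connectivity attaches both
ends to the complement. -/
theorem IsFace.isTypeOneLink_of_mem [Finite V] (hnadj : ¬ G.Adj m₁ m₂)
    (h3 : NoTwoSep (G ⊔ edge m₁ m₂)) {C : G.Subgraph} (hC : IsFace m₁ m₂ C)
    (he : s(v, w) ∈ C.edgeSet) (hi : s(v, w) ∈ (interiorGraph G m₁ m₂).edgeSet)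
    (hm : m₁ ∈ C.verts ∨ m₂ ∈ C.verts) : IsTypeOneLink G m₁ m₂ s(v, w) := by
  obtain ⟨hvw, hv, hw⟩ := mem_interiorGraph_iff.1 hi
  obtain ⟨c, n, hc, rfl, rfl, hcv, -⟩ := hC.exists_hole he
  have hattv := hc.att_compl h3 hcv (Nat.zero_le n) hv.1 hv.2
  have hattw := hc.att_compl h3 hcv le_rfl hw.1 hw.2
  refine Split.isTypeOneLink hnadj h3 hvw ?_
  rcases hm with hm | hm
  · exact (hc.split_of_mem hcv (fun r hr => (hC.reach_monitor r hr).symm) hattv hattw hm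
      hv.1.symm hw.1.symm).swap
  · exact hc.split_of_mem hcv hC.reach_monitor hattv hattw hm hv.2.symm hw.2.symm

theorem IsBorderLink.exists_face [Finite V] (hnadj : ¬ G.Adj m₁ m₂)
    (h3 : NoTwoSep (G ⊔ edge m₁ m₂)) {e : Sym2 V} (he : IsBorderLink G m₁ m₂ e) :
    ∃ C : G.Subgraph, IsFace m₁ m₂ C ∧ e ∈ C.edgeSet ∧ m₁ ∉ C.verts ∧ m₂ ∉ C.verts := by
  induction e with | h v w
  obtain ⟨hi, hnot⟩ := he
  obtain ⟨hvw, hv, hw⟩ := mem_interiorGraph_iff.1 hi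
  -- A walk from `v` to `z` avoiding `m₁`, `w`, then one from `z` to `w` avoiding `m₁`, `v`: each
  -- misses an end of the link, so neither uses it.
  obtain ⟨z, hzm, hzv, hzw⟩ := h3.exists_ne m₁ v w
  have hvz := h3.reach m₁ w v z hv.1 hvw.ne hzm hzw
  have hzw' := h3.reach m₁ v z w hzm hzv hw.1 hvw.ne'
  have key : ∀ x, x = v ∨ x = w → ∀ a ∈ ({m₁, x}ᶜ : Set V), ∀ b ∈ ({m₁, x}ᶜ : Set V),
      (G ⊔ edge m₁ m₂).Adj a b → ((G ⊔ edge m₁ m₂).deleteEdges {s(v, w)}).Adj a b := by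
    intro x hx a ha b hb hab
    rw [deleteEdges_adj]
    refine ⟨hab, fun h => ?_⟩
    simp only [Set.mem_compl_iff, Set.mem_insert_iff, Set.mem_singleton_iff, not_or] at ha hb
    rcases Sym2.eq_iff.1 h with ⟨h, h'⟩ | ⟨h, h'⟩ <;> rcases hx with hx | hx <;> grind
  obtain ⟨C, hC, hCe, hCd⟩ := exists_face_disjoint hnadj h3 hvw (B₀ := {m₁}) rfl (.inl rfl)
    (.singleton _) (fun h => hv.1 h) (fun h => hw.1 h)
    (((hvz.map_adj (key w (.inr rfl))).mono fun x hx h => hx (.inl h)).trans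
      ((hzw'.map_adj (key v (.inl rfl))).mono fun x hx h => hx (.inl h)))
  exact ⟨C, hC, hCe, fun h => hnot (hC.isTypeOneLink_of_mem hnadj h3 hCe hi (.inl h)),
    fun h => hnot (hC.isTypeOneLink_of_mem hnadj h3 hCe hi (.inr h))⟩

end Split

/-! ### Attachments to a face, and separators of its stretches -/

section Border

variable {V : Type*} {G : SimpleGraph V} {m₁ m₂ v w : V}

/-- A partition of the complement of `C` into two connected sets, one around each monitor. -/
structure IsMonitorPartition (G : SimpleGraph V) (C : Set V) (m₁ m₂ : V) (M₁ M₂ : Set V) :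
    Prop where
  conn₁ : ConnSet G M₁
  conn₂ : ConnSet G M₂
  disj : Disjoint M₁ M₂
  mem₁ : m₁ ∈ M₁
  mem₂ : m₂ ∈ M₂
  union : M₁ ∪ M₂ = Cᶜ

namespace IsMonitorPartition

variable {C M₁ M₂ : Set V}

theorem swap (h : IsMonitorPartition G C m₁ m₂ M₁ M₂) : IsMonitorPartition G C m₂ m₁ M₂ M₁ :=
  ⟨h.conn₂, h.conn₁, h.disj.symm, h.mem₂, h.mem₁, by rw [Set.union_comm, h.union]⟩

theorem notMem₁ (h : IsMonitorPartition G C m₁ m₂ M₁ M₂) {x : V} (hx : x ∈ M₁) : x ∉ C :=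
  h.union.subset (.inl hx)

theorem notMem₂ (h : IsMonitorPartition G C m₁ m₂ M₁ M₂) {x : V} (hx : x ∈ M₂) : x ∉ C :=
  h.union.subset (.inr hx)

theorem att_or (h : IsMonitorPartition G C m₁ m₂ M₁ M₂) {x : V} (hx : Att G Cᶜ x) :
    Att G M₁ x ∨ Att G M₂ x := by
  obtain ⟨y, hy, hyx⟩ := hx
  rw [← h.union] at hy
  exact hy.imp (fun hy => ⟨y, hy, hyx⟩) fun hy => ⟨y, hy, hyx⟩

/-- Two stretches of the cycle, attached to one part each, split the closing link. -/
theorem split_of_att_opposite (h : IsMonitorPartition G C m₁ m₂ M₁ M₂) {c : ℕ → V} {n : ℕ}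
    (hc : IsHole G c n) (hC : ∀ x, x ∈ C ↔ ∃ i ≤ n, c i = x) {i j : ℕ} (hi : 1 ≤ i) (hij : i < j)
    (hj : j < n) (h0 : Att G M₁ (c 0)) (hn : Att G M₂ (c n)) (hi₂ : Att G M₂ (c i))
    (hj₁ : Att G M₁ (c j)) : Split G m₁ m₂ (c 0) (c n) := by
  have hcC : ∀ i ≤ n, c i ∈ C := fun i hi => (hC _).2 ⟨i, hi, rfl⟩
  have hsub : ∀ M : Set V, (∀ x ∈ M, x ∉ C) → M ⊆ {c 0, c n}ᶜ := by
    rintro M hM x hx (rfl | rfl)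
    exacts [hM _ hx (hcC 0 (by omega)), hM _ hx (hcC n le_rfl)]
  obtain ⟨x, hx, hxj⟩ := id hj₁
  obtain ⟨y, hy, hyi⟩ := id hi₂
  -- Each part touches one end itself and gets to the other along the stretch it absorbs; `i < j`
  -- keeps the stretches disjoint.
  refine ⟨M₁ ∪ c '' Set.Icc j (n - 1), M₂ ∪ c '' Set.Icc 1 i,
    h.conn₁.union (hc.connSet_inner (by omega)) ⟨x, hx, _, ⟨j, ⟨le_rfl, by omega⟩, rfl⟩, hxj⟩,
    h.conn₂.union (hc.connSet_inner (by omega)) ⟨y, hy, _, ⟨i, ⟨hi, le_rfl⟩, rfl⟩, hyi⟩,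
    Set.disjoint_left.2 ?_, .inl h.mem₁, .inl h.mem₂,
    Set.union_subset (hsub _ fun _ => h.notMem₁) (hc.image_subset (by omega) (by omega)),
    Set.union_subset (hsub _ fun _ => h.notMem₂) (hc.image_subset le_rfl (by omega)),
    ⟨h0.mono Set.subset_union_left, (hc.att_inner_last hj).mono Set.subset_union_right⟩,
    (hc.att_inner_zero hi).mono Set.subset_union_right, hn.mono Set.subset_union_left⟩
  rintro z (hz | ⟨s, ⟨hs1, hs2⟩, rfl⟩) (hz' | ⟨t, ⟨ht1, ht2⟩, ht⟩)
  · exact Set.disjoint_left.1 h.disj hz hz'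
  · exact h.notMem₁ hz (ht ▸ hcC t (by omega))
  · exact h.notMem₂ hz' (hcC s (by omega))
  · have := hc.inj t (by omega) s (by omega) ht
    omega

end IsMonitorPartition

/-- A part attached to both ends of a link of a face, with the other part attached elsewhere,
splits the link. -/
theorem IsFace.split_of_att {C : G.Subgraph} (hC : IsFace m₁ m₂ C) {a b : V} {M₁ M₂ : Set V}
    (h : IsMonitorPartition G C.verts a b M₁ M₂) (he : s(v, w) ∈ C.edgeSet) (hv : Att G M₁ v)
    (hw : Att G M₁ w) {x : V} (hx : x ∈ C.verts) (hxv : x ≠ v) (hxw : x ≠ w) (hx₂ : Att G M₂ x) :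
    Split G a b v w := by
  obtain ⟨c, n, hc, rfl, rfl, hcv, -⟩ := hC.exists_hole he
  have hcC : ∀ i ≤ n, c i ∈ C.verts := fun i hi => (hcv _).2 ⟨i, hi, rfl⟩
  have hsub : ∀ M : Set V, (∀ x ∈ M, x ∉ C.verts) → M ⊆ {c 0, c n}ᶜ := by
    rintro M hM x hx (rfl | rfl)
    exacts [hM _ hx (hcC 0 (by omega)), hM _ hx (hcC n le_rfl)]
  obtain ⟨i, hi, rfl⟩ := (hcv x).1 hx
  have hi0 : i ≠ 0 := fun h => hxv (by rw [h])
  have hin : i ≠ n := fun h => hxw (by rw [h])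
  obtain ⟨y, hy, hyi⟩ := hx₂
  -- `M₂` absorbs the whole cycle without `v` and `w`, through its attachment `x`.
  refine ⟨M₁, M₂ ∪ c '' Set.Icc 1 (n - 1), h.conn₁,
    h.conn₂.union (hc.connSet_inner (by omega))
      ⟨y, hy, _, ⟨i, ⟨by omega, by omega⟩, rfl⟩, hyi⟩,
    Set.disjoint_left.2 ?_, h.mem₁, .inl h.mem₂, hsub _ fun _ => h.notMem₁,
    Set.union_subset (hsub _ fun _ => h.notMem₂) (hc.image_subset le_rfl (by omega)), ⟨hv, hw⟩,
    (hc.att_inner_zero (by omega)).mono Set.subset_union_right,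
    (hc.att_inner_last (by omega)).mono Set.subset_union_right⟩
  rintro z hz (hz' | ⟨t, ⟨ht1, ht2⟩, rfl⟩)
  · exact Set.disjoint_left.1 h.disj hz hz'
  · exact h.notMem₁ hz (hcC t (by omega))

/-- Combinatorial core of the argument on two border-links of a face: `a i` and `b i` say which
part of a partition the `i`-th node is attached to. -/
theorem false_of_attachments {a b : ℕ → Prop} {n k : ℕ} (hk : 1 ≤ k) (hkn : k < n)
    (hab : ∀ i ≤ n, a i ∨ b i)
    (h1 : ∀ i ≤ n, i ≠ 0 → i ≠ n → a 0 → a n → ¬ b i)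
    (h1' : ∀ i ≤ n, i ≠ 0 → i ≠ n → b 0 → b n → ¬ a i)
    (h2 : ∀ i ≤ n, i ≠ k → i ≠ k + 1 → a k → a (k + 1) → ¬ b i)
    (h2' : ∀ i ≤ n, i ≠ k → i ≠ k + 1 → b k → b (k + 1) → ¬ a i)
    (h3 : ∀ i j, 1 ≤ i → i < j → j < n → a 0 → b n → b i → ¬ a j)
    {j : ℕ} (hj : j ≤ k) (hbj : b j) (ha0 : a 0) : False := by
  have hk' := hab k hkn.le
  have hk1 := hab (k + 1) hkn
  have hn := hab n le_rfl
  -- Here the two links share the node `n`, so `k + 1` is not an inner index for `h1` and `h3`.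
  by_cases hkn' : n = k + 1
  · subst hkn'
    have hA : ¬ a (k + 1) := fun han => by
      have hbk : ¬ b k := h1 k (by omega) (by omega) (by omega) ha0 han
      have hj0 : j = 0 := by
        by_contra hj0
        exact h1 j (by omega) hj0 (by omega) ha0 han hbj
      exact h2 j (by omega) (by omega) (by omega) (hk'.resolve_right hbk) han hbj
    have hb := hk1.resolve_left hA
    have hbk : ¬ b k := fun h => h2' 0 (by omega) (by omega) (by omega) h hb ha0
    have hak := hk'.resolve_right hbk
    have hjk : j ≠ k := fun h => hbk (h ▸ hbj)
    rcases Nat.eq_zero_or_pos j with rfl | hj0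
    · exact h1' k (by omega) (by omega) (by omega) hbj hb hak
    · exact h3 j k hj0 (by omega) hkn ha0 hb hbj hak
  -- With `a 0` and `a n`, no inner index satisfies `b`. Then `j = 0`, while `a k` and `a (k + 1)`
  -- hold, against `h2`.
  · have hA : ¬ a n := fun han => by
      have hbk : ¬ b k := h1 k (by omega) (by omega) (by omega) ha0 han
      have hbk1 : ¬ b (k + 1) := h1 (k + 1) (by omega) (by omega) (by omega) ha0 han
      have hj0 : j = 0 := by
        by_contra hj0
        exact h1 j (by omega) hj0 (by omega) ha0 han hbj
      exact h2 j (by omega) (by omega) (by omega) (hk'.resolve_right hbk)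
        (hk1.resolve_right hbk1) hbj
    have hbn := hn.resolve_left hA
    by_cases hbk : b k
    · have hak1 : ¬ a (k + 1) := h3 k (k + 1) hk (by omega) (by omega) ha0 hbn hbk
      exact h2' 0 (by omega) (by omega) (by omega) hbk (hk1.resolve_left hak1) ha0
    · have hak := hk'.resolve_right hbk
      have hjk : j ≠ k := fun h => hbk (h ▸ hbj)
      rcases Nat.eq_zero_or_pos j with rfl | hj0
      · exact h1' k (by omega) (by omega) (by omega) hbj hbn hak
      · exact h3 j k hj0 (by omega) hkn ha0 hbn hbj hak

/-- The two parts of a partition are not both attached to the stretch of a face between two links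
without a split. -/
theorem IsMonitorPartition.not_both_att {C : G.Subgraph} (hC : IsFace m₁ m₂ C) {M₁ M₂ : Set V}
    (h : IsMonitorPartition G C.verts m₁ m₂ M₁ M₂) (hatt : ∀ x ∈ C.verts, Att G C.vertsᶜ x)
    {c : ℕ → V} {n k : ℕ} (hc : IsHole G c n) (hcv : ∀ x, x ∈ C.verts ↔ ∃ i ≤ n, c i = x)
    (hk : 1 ≤ k) (hkn : k < n) (hs : ¬ Split G m₁ m₂ (c 0) (c n))
    (hs' : ¬ Split G m₁ m₂ (c k) (c (k + 1))) {i j : ℕ} (hi : i ≤ k) (hj : j ≤ k)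
    (hai : Att G M₁ (c i)) (hbj : Att G M₂ (c j)) : False := by
  have hcC : ∀ i ≤ n, c i ∈ C.verts := fun i hi => (hcv _).2 ⟨i, hi, rfl⟩
  have hab : ∀ i ≤ n, Att G M₁ (c i) ∨ Att G M₂ (c i) := fun i hi => h.att_or (hatt _ (hcC i hi))
  have hne : ∀ i ≤ n, ∀ j ≤ n, i ≠ j → c i ≠ c j := fun i hi j hj hij h => hij (hc.inj i hi j hj h)
  have he : s(c 0, c n) ∈ C.edgeSet :=
    hC.isInduced (hcC 0 (by omega)) (hcC n le_rfl) hc.closing.symm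
  have he' : s(c k, c (k + 1)) ∈ C.edgeSet :=
    hC.isInduced (hcC k hkn.le) (hcC (k + 1) hkn) (hc.adj k hkn)
  have h1 : ∀ i ≤ n, i ≠ 0 → i ≠ n → Att G M₁ (c 0) → Att G M₁ (c n) → ¬ Att G M₂ (c i) :=
    fun i hi hi0 hin h0 hn hb => hs (hC.split_of_att h he h0 hn (hcC i hi)
      (hne i hi 0 (by omega) hi0) (hne i hi n le_rfl hin) hb)
  have h1' : ∀ i ≤ n, i ≠ 0 → i ≠ n → Att G M₂ (c 0) → Att G M₂ (c n) → ¬ Att G M₁ (c i) :=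
    fun i hi hi0 hin h0 hn hb => hs (hC.split_of_att h.swap he h0 hn (hcC i hi)
      (hne i hi 0 (by omega) hi0) (hne i hi n le_rfl hin) hb).swap
  have h2 : ∀ i ≤ n, i ≠ k → i ≠ k + 1 → Att G M₁ (c k) → Att G M₁ (c (k + 1)) →
      ¬ Att G M₂ (c i) :=
    fun i hi hi0 hin h0 hn hb => hs' (hC.split_of_att h he' h0 hn (hcC i hi)
      (hne i hi k (by omega) hi0) (hne i hi (k + 1) (by omega) hin) hb)
  have h2' : ∀ i ≤ n, i ≠ k → i ≠ k + 1 → Att G M₂ (c k) → Att G M₂ (c (k + 1)) →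
      ¬ Att G M₁ (c i) :=
    fun i hi hi0 hin h0 hn hb => hs' (hC.split_of_att h.swap he' h0 hn (hcC i hi)
      (hne i hi k (by omega) hi0) (hne i hi (k + 1) (by omega) hin) hb).swap
  rcases hab 0 (by omega) with h0 | h0
  · exact false_of_attachments (a := fun i => Att G M₁ (c i)) (b := fun i => Att G M₂ (c i)) hk hkn
      hab h1 h1' h2 h2' (fun i j hi hij hj h0 hn hbi haj => hs
        (h.split_of_att_opposite hc hcv hi hij hj h0 hn hbi haj)) hj hbj h0
  · exact false_of_attachments (a := fun i => Att G M₂ (c i)) (b := fun i => Att G M₁ (c i)) hk hkn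
      (fun i hi => (hab i hi).symm) h1' h1 h2' h2 (fun i j hi hij hj h0 hn hbi haj => hs
        (h.swap.split_of_att_opposite hc hcv hi hij hj h0 hn hbi haj).swap) hi hai h0

/-- The node `t` meets every walk outside `C` from a monitor to a neighbour of `L`. -/
def Separates (G : SimpleGraph V) (C : Set V) (m₁ m₂ : V) (L : Set V) (t : V) : Prop :=
  ∀ m, (m = m₁ ∨ m = m₂) → ∀ y, Att G L y → ¬ ReachIn G (Cᶜ \ {t}) m y

/-- The nodes of `L` and those outside `C` that reach a neighbour of `L` without `t`. -/
def side (G : SimpleGraph V) (C L : Set V) (t : V) : Set V :=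
  L ∪ {r | ∃ y, Att G L y ∧ ReachIn G (Cᶜ \ {t}) r y}

/-- Menger's theorem off `C`, with the neighbours of `L` as targets. Since every node off a face
reaches a monitor, the two disjoint connected sets extend to a partition of the complement. -/
theorem exists_partition_or_separates [Finite V] {C : G.Subgraph} (hC : IsFace m₁ m₂ C)
    (hne : m₁ ≠ m₂) (hm₁ : m₁ ∉ C.verts)
    (hatt : ∀ x ∈ C.verts, Att G C.vertsᶜ x) {L : Set V} (hL : L ⊆ C.verts) (hLne : L.Nonempty) :
    (∃ M₁ M₂, IsMonitorPartition G C.verts m₁ m₂ M₁ M₂ ∧ (∃ x ∈ L, Att G M₁ x) ∧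
      ∃ x ∈ L, Att G M₂ x) ∨ ∃ t ∉ C.verts, Separates G C.verts m₁ m₂ L t := by
  rcases exists_disjoint_connSet_or_separator G C.vertsᶜ {y | Att G L y} hm₁ hne with
    ⟨A, B, hA, hB, hAB, ha, hb, hAR, hBR, ⟨x, hx, l, hl, hlx⟩, y, hy, l', hl', hly⟩ | ⟨s, hs⟩
  · obtain ⟨M₁, M₂, hAM, hBM, h₁, h₂, hd, hu⟩ :=
      exists_partition G hC.reach_monitor hA hB hAB ha hb hAR hBR
    exact .inl ⟨M₁, M₂, ⟨h₁, h₂, hd, hAM ha, hBM hb, hu⟩, ⟨l, hl, x, hAM hx, hlx.symm⟩,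
      l', hl', y, hBM hy, hly.symm⟩
  -- A separator on `C` would remove nothing from the complement, yet `L` has a neighbour there that
  -- reaches a monitor.
  · refine .inr ⟨s, fun hsC => ?_, hs⟩
    obtain ⟨l, hl⟩ := hLne
    obtain ⟨r, hr, hrl⟩ := hatt l (hL hl)
    have hsub : C.vertsᶜ ⊆ C.vertsᶜ \ {s} := fun x hx => ⟨hx, fun h => hx (h ▸ hsC)⟩
    rcases hC.reach_monitor r hr with h | h
    · exact hs _ (.inl rfl) r ⟨l, hl, hrl.symm⟩ (h.symm.mono hsub)
    · exact hs _ (.inr rfl) r ⟨l, hl, hrl.symm⟩ (h.symm.mono hsub)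

section Side

variable {C L : Set V} {t : V}

theorem Separates.monitor_notMem_side (h : Separates G C m₁ m₂ L t) (hL : L ⊆ C) (hm₁ : m₁ ∉ C)
    (hm₂ : m₂ ∉ C) {x : V} (hx : x ∈ side G C L t) : x ≠ m₁ ∧ x ≠ m₂ := by
  rcases hx with hx | ⟨y, hy, hr⟩
  · exact ⟨fun h => hm₁ (h ▸ hL hx), fun h => hm₂ (h ▸ hL hx)⟩
  · exact ⟨fun e => h x (.inl e) y hy hr, fun e => h x (.inr e) y hy hr⟩

theorem mem_side_or_of_adj {x y : V} (hx : x ∈ side G C L t) (hxy : G.Adj x y) (hy : y ∉ C) :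
    y ∈ side G C L t ∨ y = t := by
  by_cases hyt : y = t
  · exact .inr hyt
  left; right
  rcases hx with hx | ⟨z, hz, hr⟩
  · exact ⟨y, ⟨x, hx, hxy⟩, .refl ⟨hy, hyt⟩⟩
  · exact ⟨z, hz, ReachIn.trans (.of_adj hxy.symm ⟨hy, hyt⟩ hr.left_mem) hr⟩

/-- A separator together with one more node cannot cut all of a face from a monitor. -/
theorem Separates.false_of_subset_insert (h3 : NoTwoSep (G ⊔ edge m₁ m₂)) (hne : m₁ ≠ m₂)
    (h : Separates G C m₁ m₂ L t) (hL : L ⊆ C) (hm₁ : m₁ ∉ C) (hm₂ : m₂ ∉ C) (ht : t ∉ C) {u l : V}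
    (hu : u ∈ C) (hl : l ∈ L) (hlu : l ≠ u) (hCL : C ⊆ insert u L) : False := by
  obtain ⟨m, hm, hmt⟩ : ∃ m, (m = m₁ ∨ m = m₂) ∧ m ≠ t := by
    by_cases h1 : m₁ = t
    · exact ⟨m₂, .inr rfl, fun h2 => hne (h1.trans h2.symm)⟩
    · exact ⟨m₁, .inl rfl, h1⟩
  have hmC : m ∉ C := by rcases hm with rfl | rfl <;> assumption
  have hr := h3.reach t u l m (fun e => ht (e ▸ hL hl)) hlu hmt fun e => hmC (e ▸ hu)
  have hmem : m ∈ side G C L t := by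
    -- Away from `t` and `u` the side of `L` is closed. It holds no monitor, so the link `m₁m₂`
    -- never leads out of it.
    refine hr.mem_of_closed (.inl hl) fun x hx y hy hxy => ?_
    simp only [Set.mem_compl_iff, Set.mem_insert_iff, Set.mem_singleton_iff, not_or] at hy
    obtain ⟨hx₁, hx₂⟩ := h.monitor_notMem_side hL hm₁ hm₂ hx
    have hadj : G.Adj x y := by
      rcases sup_edge_adj.1 hxy with h | ⟨⟨h, -⟩ | ⟨h, -⟩, -⟩
      exacts [h, absurd h hx₁, absurd h hx₂]
    by_cases hyC : y ∈ C
    · exact .inl ((hCL hyC).resolve_left hy.2)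
    · exact (mem_side_or_of_adj hx hadj hyC).resolve_right hy.1
  obtain ⟨h₁, h₂⟩ := h.monitor_notMem_side hL hm₁ hm₂ hmem
  exact hm.elim h₁ h₂

/-- If single nodes separate the monitors from two complementary stretches of a face, then the
links between the stretches form an edge cut. -/
theorem Separates.false_of_union (hnadj : ¬ G.Adj m₁ m₂) (h3 : NoTwoSep (G ⊔ edge m₁ m₂))
    (hne : m₁ ≠ m₂) {E : Set (Sym2 V)} {L' : Set V} {t' l l' : V} (h : Separates G C m₁ m₂ L t)
    (h' : Separates G C m₁ m₂ L' t') (hanch : ∀ r ∈ Cᶜ, ReachIn G Cᶜ r m₁ ∨ ReachIn G Cᶜ r m₂)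
    (hLL' : L ∪ L' = C) (hdisj : Disjoint L L')
    (hm₁ : m₁ ∉ C) (hm₂ : m₂ ∉ C) (ht : t ∉ C) (ht' : t' ∉ C) (hl : l ∈ L) (hl' : l' ∈ L')
    (hE : ∀ x ∈ L, ∀ y ∈ L', G.Adj x y → s(x, y) ∈ E)
    (hreach : (G.deleteEdges E).Reachable l l') : False := by
  have hL : L ⊆ C := hLL' ▸ Set.subset_union_left
  have hL' : L' ⊆ C := hLL' ▸ Set.subset_union_right
  -- the two sides are everything but the separators
  have hall : ∀ z, z ≠ t → z ≠ t' → z ∈ side G C L t ∪ side G C L' t' := by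
    intro z hzt hzt'
    refine (h3.reach t t' l z (fun e => ht (e ▸ hL hl)) (fun e => ht' (e ▸ hL hl)) hzt
      hzt').mem_of_closed (.inl (.inl hl)) fun x hx y hy hxy => ?_
    simp only [Set.mem_compl_iff, Set.mem_insert_iff, Set.mem_singleton_iff, not_or] at hy
    obtain ⟨hx₁, hx₂⟩ : x ≠ m₁ ∧ x ≠ m₂ :=
      hx.elim (h.monitor_notMem_side hL hm₁ hm₂) (h'.monitor_notMem_side hL' hm₁ hm₂)
    have hadj : G.Adj x y := by
      rcases sup_edge_adj.1 hxy with h | ⟨⟨h, -⟩ | ⟨h, -⟩, -⟩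
      exacts [h, absurd h hx₁, absurd h hx₂]
    by_cases hyC : y ∈ C
    · rw [← hLL'] at hyC
      exact hyC.imp .inl .inl
    · exact hx.imp (fun hx => (mem_side_or_of_adj hx hadj hyC).resolve_right hy.1)
        fun hx => (mem_side_or_of_adj hx hadj hyC).resolve_right hy.2
  -- No monitor lies on either side, so only the separators are left for them.
  have hm : ∀ m, (m = m₁ ∨ m = m₂) → m = t ∨ m = t' := by
    intro m hm
    by_contra hno
    push Not at hno
    obtain ⟨h₁, h₂⟩ := (hall m hno.1 hno.2).elim (h.monitor_notMem_side hL hm₁ hm₂)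
      (h'.monitor_notMem_side hL' hm₁ hm₂)
    exact hm.elim h₁ h₂
  have ht12 : (t = m₁ ∧ t' = m₂) ∨ (t = m₂ ∧ t' = m₁) := by
    rcases hm m₁ (.inl rfl) with h1 | h1 <;> rcases hm m₂ (.inr rfl) with h2 | h2
    · exact absurd (h1.trans h2.symm) hne
    · exact .inl ⟨h1.symm, h2.symm⟩
    · exact .inr ⟨h2.symm, h1.symm⟩
    · exact absurd (h1.trans h2.symm) hne
  have htt' : t ≠ t' := by
    rcases ht12 with ⟨rfl, rfl⟩ | ⟨rfl, rfl⟩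
    exacts [hne, hne.symm]
  have htm : t = m₁ ∨ t = m₂ := ht12.imp And.left And.left
  have htadj : ¬ G.Adj t t' := by
    rcases ht12 with ⟨rfl, rfl⟩ | ⟨rfl, rfl⟩
    exacts [hnadj, fun h => hnadj h.symm]
  -- no node outside the face reaches both stretches
  have hboth : ∀ r, (∃ y, Att G L y ∧ ReachIn G (Cᶜ \ {t}) r y) →
      (∃ y, Att G L' y ∧ ReachIn G (Cᶜ \ {t'}) r y) → False := by
    rintro r ⟨y, hy, hr⟩ ⟨y', hy', hr'⟩
    obtain ⟨m, hm', hrm⟩ : ∃ m, (m = m₁ ∨ m = m₂) ∧ ReachIn G Cᶜ r m :=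
      (hanch r hr.left_mem.1).elim (fun h => ⟨_, .inl rfl, h⟩) fun h => ⟨_, .inr rfl, h⟩
    -- The first separator met is a monitor, joined through `r` to the other separator's stretch
    -- without that other separator.
    obtain ⟨x, hx, -, hrx⟩ := hrm.exists_first (T := {t, t'}) (hm m hm')
    have hxt : ∀ s, (s = t ∨ s = t') → x ≠ s → ReachIn G (Cᶜ \ {s}) r x := by
      intro s hs hxs
      refine hrx.mono ?_
      rintro z (rfl | hz)
      · rcases hx with rfl | rfl
        exacts [⟨ht, hxs⟩, ⟨ht', hxs⟩]
      · exact ⟨hz.1, fun e => hz.2 (by rw [Set.mem_singleton_iff] at e; exact e ▸ hs)⟩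
    rcases hx with rfl | rfl
    · exact h' x htm y' hy' ((hxt t' (.inr rfl) htt').symm.trans hr')
    · have : x = m₁ ∨ x = m₂ := ht12.elim (fun h => .inr h.2) fun h => .inl h.2
      exact h x this y hy ((hxt t (.inl rfl) htt'.symm).symm.trans hr)
  -- Once `E` is deleted, nothing leaves the side of `L` together with `t`: `t` is a monitor, not
  -- adjacent to `t'`, and cut from `L'` by `t'`.
  have hmem : l' ∈ insert t (side G C L t) := by
    obtain ⟨p⟩ := hreach
    have hp : ReachIn (G.deleteEdges E) Set.univ l l' := ⟨p, fun _ _ => trivial⟩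
    refine hp.mem_of_closed (.inr (.inl hl)) fun x hx y _ hxy => ?_
    rw [deleteEdges_adj] at hxy
    by_cases hyt : y = t
    · exact .inl hyt
    right
    rcases hx with rfl | hx
    · have hyt' : y ≠ t' := fun e => htadj (e ▸ hxy.1)
      refine (hall y hyt hyt').resolve_right ?_
      rintro (hy | ⟨z, hz, hr⟩)
      · exact h' x htm x ⟨y, hy, hxy.1.symm⟩ (.refl ⟨ht, htt'⟩)
      · exact h' x htm z hz (ReachIn.trans (.of_adj hxy.1 ⟨ht, htt'⟩ hr.left_mem) hr)
    · by_cases hyC : y ∈ C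
      · rw [← hLL'] at hyC
        refine .inl (hyC.resolve_right fun hyL' => ?_)
        rcases hx with hx | hx
        · exact hxy.2 (hE x hx y hyL' hxy.1)
        · obtain ⟨z, hz, hr⟩ := id hx
          have hxt' : x ≠ t' := by
            have := h.monitor_notMem_side hL hm₁ hm₂ (.inr hx)
            rcases ht12 with ⟨-, rfl⟩ | ⟨-, rfl⟩
            exacts [this.2, this.1]
          exact hboth x hx ⟨x, ⟨y, hyL', hxy.1.symm⟩, .refl ⟨hr.left_mem.1, hxt'⟩⟩
      · exact (mem_side_or_of_adj hx hxy.1 hyC).resolve_right hyt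
  rcases hmem with rfl | hmem | ⟨z, hz, hr⟩
  · exact ht (hL' hl')
  · exact Set.disjoint_left.1 hdisj hmem hl'
  · exact hr.left_mem.1 (hL' hl')

end Side

end Border

/-! ### Border-links: disjoint paths, and at most one on each face -/

section BorderLinks

variable {V : Type*} {G : SimpleGraph V} {m₁ m₂ v w : V}

theorem IsBorderLink.adj (h : IsBorderLink G m₁ m₂ s(v, w)) : G.Adj v w :=
  (mem_interiorGraph_iff.1 h.1).1

theorem IsBorderLink.not_split [Finite V] (hnadj : ¬ G.Adj m₁ m₂)
    (h3 : NoTwoSep (G ⊔ edge m₁ m₂))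
    (h : IsBorderLink G m₁ m₂ s(v, w)) : ¬ Split G m₁ m₂ v w :=
  fun hs => h.2 (hs.isTypeOneLink hnadj h3 h.adj)

theorem IsBorderLink.monitor_notMem [Finite V] (hnadj : ¬ G.Adj m₁ m₂)
    (h3 : NoTwoSep (G ⊔ edge m₁ m₂))
    (h : IsBorderLink G m₁ m₂ s(v, w)) {C : G.Subgraph} (hC : IsFace m₁ m₂ C)
    (he : s(v, w) ∈ C.edgeSet) : m₁ ∉ C.verts ∧ m₂ ∉ C.verts :=
  ⟨fun hm => h.2 (hC.isTypeOneLink_of_mem hnadj h3 he h.1 (.inl hm)),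
    fun hm => h.2 (hC.isTypeOneLink_of_mem hnadj h3 he h.1 (.inr hm))⟩

theorem IsHole.att_of_monitor_notMem {c : ℕ → V} {n : ℕ} (hc : IsHole G c n)
    (h3 : NoTwoSep (G ⊔ edge m₁ m₂)) {C : Set V} (hC : ∀ x, x ∈ C ↔ ∃ i ≤ n, c i = x)
    (hm₁ : m₁ ∉ C) (hm₂ : m₂ ∉ C) : ∀ x ∈ C, Att G Cᶜ x := by
  intro x hx
  obtain ⟨i, hi, rfl⟩ := (hC x).1 hx
  exact hc.att_compl h3 hC hi (fun e => hm₁ (e ▸ hx)) fun e => hm₂ (e ▸ hx)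

theorem exists_disjoint_paths_of_att {C : Set V} {M₁ M₂ : Set V}
    (h : IsMonitorPartition G C m₁ m₂ M₁ M₂) (hv : v ∈ C) (hw : w ∈ C) (hvw : v ≠ w)
    (hv₁ : Att G M₁ v) (hw₂ : Att G M₂ w) :
    ∃ (P : G.Path m₁ v) (Q : G.Path m₂ w), (∀ z ∈ P.1.support, z ∉ Q.1.support) ∧
      (∀ z ∈ P.1.support, z ∈ C → z = v) ∧ ∀ z ∈ Q.1.support, z ∈ C → z = w := by
  obtain ⟨x, hx, hxv⟩ := hv₁
  obtain ⟨y, hy, hyw⟩ := hw₂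
  obtain ⟨P, hP⟩ := (((h.conn₁ m₁ h.mem₁ x hx).mono (Set.subset_insert v M₁)).trans
    (.of_adj hxv (.inr hx) (.inl rfl))).exists_path
  obtain ⟨Q, hQ⟩ := (((h.conn₂ m₂ h.mem₂ y hy).mono (Set.subset_insert w M₂)).trans
    (.of_adj hyw (.inr hy) (.inl rfl))).exists_path
  refine ⟨P, Q, fun z hz hz' => ?_, fun z hz hzC => ?_, fun z hz hzC => ?_⟩
  · rcases hP z hz with rfl | h1 <;> rcases hQ z hz' with h2 | h2
    · exact hvw h2
    · exact h.notMem₂ h2 hv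
    · exact h.notMem₁ h1 (h2 ▸ hw)
    · exact Set.disjoint_left.1 h.disj h1 h2
  · exact (hP z hz).resolve_right fun h1 => h.notMem₁ h1 hzC
  · exact (hQ z hz).resolve_right fun h1 => h.notMem₂ h1 hzC

theorem IsBorderLink.exists_disjoint_paths [Finite V] (hne : m₁ ≠ m₂)
    (hnadj : ¬ G.Adj m₁ m₂) (h3 : NoTwoSep (G ⊔ edge m₁ m₂)) {C : G.Subgraph} (hC : IsFace m₁ m₂ C) {e : Sym2 V}
    (he : e ∈ C.edgeSet) (h : IsBorderLink G m₁ m₂ e) :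
    ∃ v w : V, e = s(v, w) ∧ ∃ (P : G.Path m₁ v) (Q : G.Path m₂ w),
      (∀ z ∈ P.1.support, z ∉ Q.1.support) ∧
      (∀ z ∈ P.1.support, z ∈ C.verts → z = v) ∧ ∀ z ∈ Q.1.support, z ∈ C.verts → z = w := by
  induction e with | h v w
  obtain ⟨hm₁, hm₂⟩ := h.monitor_notMem hnadj h3 hC he
  have hs := h.not_split hnadj h3
  have hvw := h.adj.ne
  have hv : v ∈ C.verts := C.edge_vert he
  have hw : w ∈ C.verts := C.edge_vert (Subgraph.Adj.symm he)
  obtain ⟨c, n, hc, -, -, hcv, -⟩ := hC.exists_hole he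
  have hatt := hc.att_of_monitor_notMem h3 hcv hm₁ hm₂
  rcases exists_partition_or_separates hC hne hm₁ hatt subset_rfl ⟨v, hv⟩ with
    ⟨M₁, M₂, hM, ⟨x, hx, hx₁⟩, y, hy, hy₂⟩ | ⟨t, ht, hsep⟩
  · have hav := hM.att_or (hatt v hv)
    have haw := hM.att_or (hatt w hw)
    -- If `M₁` holds both ends, an attachment of `M₂` elsewhere would split the link; so `M₂` is
    -- attached to an end as well.
    have h1 : Att G M₁ v → Att G M₁ w → y = v ∨ y = w := fun hv₁ hw₁ => by
      by_contra hno
      push Not at hno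
      exact hs (hC.split_of_att hM he hv₁ hw₁ hy hno.1 hno.2 hy₂)
    have h2 : Att G M₂ v → Att G M₂ w → x = v ∨ x = w := fun hv₂ hw₂ => by
      by_contra hno
      push Not at hno
      exact hs (hC.split_of_att hM.swap he hv₂ hw₂ hx hno.1 hno.2 hx₁).swap
    have hcases : (Att G M₁ v ∧ Att G M₂ w) ∨ (Att G M₁ w ∧ Att G M₂ v) := by
      rcases hav with hv₁ | hv₂ <;> rcases haw with hw₁ | hw₂
      · rcases h1 hv₁ hw₁ with rfl | rfl
        exacts [.inr ⟨hw₁, hy₂⟩, .inl ⟨hv₁, hy₂⟩]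
      · exact .inl ⟨hv₁, hw₂⟩
      · exact .inr ⟨hw₁, hv₂⟩
      · rcases h2 hv₂ hw₂ with rfl | rfl
        exacts [.inl ⟨hx₁, hw₂⟩, .inr ⟨hx₁, hv₂⟩]
    rcases hcases with ⟨h1, h2⟩ | ⟨h1, h2⟩
    · exact ⟨v, w, rfl, exists_disjoint_paths_of_att hM hv hw hvw h1 h2⟩
    · exact ⟨w, v, Sym2.eq_swap, exists_disjoint_paths_of_att hM hw hv hvw.symm h1 h2⟩
  -- With `L` the whole face, `t` and `w` would cut `v` from a monitor.
  · exact (hsep.false_of_subset_insert h3 hne subset_rfl hm₁ hm₂ ht hw hv hvw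
      (Set.subset_insert _ _)).elim

theorem IsBorderLink.eq_of_mem_face [Finite V] (hne : m₁ ≠ m₂) (hnadj : ¬ G.Adj m₁ m₂)
    (h3 : NoTwoSep (G ⊔ edge m₁ m₂))
    (hcond : ∀ l ∈ (interiorGraph G m₁ m₂).edgeSet, (G.deleteEdges {l}).IsEdgeConnected 2)
    {C : G.Subgraph} (hC : IsFace m₁ m₂ C) {e e' : Sym2 V}
    (he : e ∈ C.edgeSet) (he' : e' ∈ C.edgeSet) (hb : IsBorderLink G m₁ m₂ e)
    (hb' : IsBorderLink G m₁ m₂ e') : e = e' := by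
  by_contra hee
  induction e with | h v w
  obtain ⟨hm₁, hm₂⟩ := hb.monitor_notMem hnadj h3 hC he
  obtain ⟨c, n, hc, rfl, rfl, hcv, hce⟩ := hC.exists_hole he
  obtain ⟨k, hkn, rfl⟩ := (hce e' he').resolve_left fun h => hee h.symm
  have hatt := hc.att_of_monitor_notMem h3 hcv hm₁ hm₂
  have hs := hb.not_split hnadj h3
  have hs' := hb'.not_split hnadj h3
  have h2 := hc.two_le
  have hcC : ∀ i ≤ n, c i ∈ C.verts := fun i hi => (hcv _).2 ⟨i, hi, rfl⟩
  have hsubL : c '' Set.Icc 0 k ⊆ C.verts := by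
    rintro _ ⟨i, hi, rfl⟩
    exact hcC i (hi.2.trans hkn.le)
  have hsubR : c '' Set.Icc (k + 1) n ⊆ C.verts := by
    rintro _ ⟨i, hi, rfl⟩
    exact hcC i hi.2
  have hcn0 : c n ≠ c 0 := hc.closing.ne
  have hsepL : 1 ≤ k → ∃ t ∉ C.verts, Separates G C.verts m₁ m₂ (c '' Set.Icc 0 k) t := by
    intro hk
    refine (exists_partition_or_separates hC hne hm₁ hatt hsubL
      ⟨_, 0, ⟨le_rfl, by omega⟩, rfl⟩).resolve_left ?_
    rintro ⟨M₁, M₂, hM, ⟨_, ⟨i, hi, rfl⟩, hi₁⟩, _, ⟨j, hj, rfl⟩, hj₂⟩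
    exact hM.not_both_att hC hatt hc hcv hk hkn hs hs' hi.2 hj.2 hi₁ hj₂
  have hsepR : k + 1 < n →
      ∃ t ∉ C.verts, Separates G C.verts m₁ m₂ (c '' Set.Icc (k + 1) n) t := by
    intro hk
    refine (exists_partition_or_separates hC hne hm₁ hatt hsubR
      ⟨_, n, ⟨by omega, le_rfl⟩, rfl⟩).resolve_left ?_
    rintro ⟨M₁, M₂, hM, ⟨_, ⟨i, hi, rfl⟩, hi₁⟩, _, ⟨j, hj, rfl⟩, hj₂⟩
    have hcv' : ∀ x, x ∈ C.verts ↔ ∃ i ≤ n, c (n - i) = x := fun x => by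
      rw [hcv]
      constructor
      · rintro ⟨i, hi, rfl⟩
        exact ⟨n - i, by omega, by rw [Nat.sub_sub_self hi]⟩
      · rintro ⟨i, hi, rfl⟩
        exact ⟨n - i, by omega, rfl⟩
    have hi2 := hi.1
    have hj2 := hj.1
    -- Reversal turns the second stretch into an initial one, ending at index `n - (k + 1)`.
    refine hM.not_both_att hC hatt hc.reverse hcv' (k := n - (k + 1)) (by omega) (by omega)
      ?_ ?_ (i := n - i) (j := n - j) (by omega) (by omega) ?_ ?_
    · intro h
      rw [Nat.sub_zero, Nat.sub_self] at h
      exact hs h.swap_ends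
    · intro h
      rw [Nat.sub_sub_self hkn, show n - (n - (k + 1) + 1) = k by omega] at h
      exact hs' h.swap_ends
    · rwa [Nat.sub_sub_self hi.2]
    · rwa [Nat.sub_sub_self hj.2]
  rcases Nat.eq_zero_or_pos k with rfl | hk
  -- The links share `c 0`, which alone is the first stretch and completes the separating pair.
  · obtain ⟨t, ht, hsep⟩ := hsepR (by omega)
    refine hsep.false_of_subset_insert h3 hne hsubR hm₁ hm₂ ht (hcC 0 (by omega))
      (l := c n) ⟨n, ⟨by omega, le_rfl⟩, rfl⟩ hcn0 fun x hx => ?_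
    obtain ⟨i, hi, rfl⟩ := (hcv x).1 hx
    rcases Nat.eq_zero_or_pos i with rfl | hi0
    exacts [.inl rfl, .inr ⟨i, ⟨by omega, hi⟩, rfl⟩]
  obtain ⟨t, ht, hsep⟩ := hsepL hk
  rcases Nat.lt_or_ge (k + 1) n with hk1 | hk1
  · obtain ⟨t', ht', hsep'⟩ := hsepR hk1
    -- Without the first border-link `G` is still 2-edge-connected, so the second may go too.
    have hreach := (hcond _ hb.1) (c 0) (c n) (s := {s(c k, c (k + 1))})
      (by rw [Set.encard_singleton]; norm_num)
    rw [deleteEdges_deleteEdges] at hreach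
    refine hsep.false_of_union hnadj h3 hne hsep' hC.reach_monitor ?_ ?_ hm₁ hm₂ ht ht'
      ⟨0, ⟨le_rfl, by omega⟩, rfl⟩ ⟨n, ⟨by omega, le_rfl⟩, rfl⟩ ?_ hreach
    · refine (Set.union_subset hsubL hsubR).antisymm fun x hx => ?_
      obtain ⟨i, hi, rfl⟩ := (hcv x).1 hx
      rcases Nat.lt_or_ge k i with h | h
      exacts [.inr ⟨i, ⟨h, hi⟩, rfl⟩, .inl ⟨i, ⟨by omega, h⟩, rfl⟩]
    · refine Set.disjoint_left.2 ?_
      rintro _ ⟨i, ⟨-, hi⟩, rfl⟩ ⟨j, ⟨hj, hj'⟩, hij⟩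
      have := hc.inj j hj' i (by omega) hij
      omega
    · rintro _ ⟨i, ⟨-, hi⟩, rfl⟩ _ ⟨j, ⟨hj, hj'⟩, rfl⟩ hadj
      -- As the cycle is chordless, only the two border-links join the stretches.
      rcases hc.chord i j (by omega) hj' hadj with h | ⟨rfl, rfl⟩
      · obtain rfl : i = k := by omega
        exact .inr (by rw [h]; rfl)
      · exact .inl rfl
  · obtain rfl : n = k + 1 := by omega
    refine hsep.false_of_subset_insert h3 hne hsubL hm₁ hm₂ ht (hcC (k + 1) le_rfl)
      (l := c 0) ⟨0, ⟨le_rfl, by omega⟩, rfl⟩ hcn0.symm fun x hx => ?_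
    obtain ⟨i, hi, rfl⟩ := (hcv x).1 hx
    rcases Nat.lt_or_ge k i with h | h
    · exact .inl (by rw [show i = k + 1 by omega])
    · exact .inr ⟨i, ⟨by omega, h⟩, rfl⟩

end BorderLinks

end TwoMonitor

theorem mainTheorem1 {V : Type*} [Finite V] (G : SimpleGraph V) (m₁ m₂ : V)
    (hne : m₁ ≠ m₂) (hnadj : ¬ G.Adj m₁ m₂)
    (hcond1 : ∀ l ∈ (TwoMonitor.interiorGraph G m₁ m₂).edgeSet,
      (G.deleteEdges {l}).IsEdgeConnected 2)
    (hcond2 : TwoMonitor.IsVertexConnected 3 (G ⊔ SimpleGraph.edge m₁ m₂)) :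
    -- (a) every face contains at most one border-link
    (∀ C : G.Subgraph, TwoMonitor.IsFace m₁ m₂ C →
      ∀ e ∈ C.edgeSet, ∀ e' ∈ C.edgeSet,
        TwoMonitor.IsBorderLink G m₁ m₂ e → TwoMonitor.IsBorderLink G m₁ m₂ e' → e = e') ∧
    -- (b) every border-link lies on a face that avoids both monitors
    (∀ e : Sym2 V, TwoMonitor.IsBorderLink G m₁ m₂ e →
      ∃ C : G.Subgraph, TwoMonitor.IsFace m₁ m₂ C ∧ e ∈ C.edgeSet ∧
        m₁ ∉ C.verts ∧ m₂ ∉ C.verts) ∧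
    -- (c) disjoint paths from the two monitors to the two ends of a border-link
    (∀ C : G.Subgraph, TwoMonitor.IsFace m₁ m₂ C →
      C.edgeSet ⊆ (TwoMonitor.interiorGraph G m₁ m₂).edgeSet →
      ∀ e ∈ C.edgeSet, TwoMonitor.IsBorderLink G m₁ m₂ e →
        ∃ v w : V, e = s(v, w) ∧
          ∃ (P : G.Path m₁ v) (Q : G.Path m₂ w),
            (∀ z ∈ P.1.support, z ∉ Q.1.support) ∧
            (∀ z ∈ P.1.support, z ∈ C.verts → z = v) ∧
            (∀ z ∈ Q.1.support, z ∈ C.verts → z = w)) := by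
  have h3 := hcond2.noTwoSep
  exact ⟨fun C hC e he e' he' hb hb' => hb.eq_of_mem_face hne hnadj h3 hcond1 hC he he' hb',
    fun e hb => hb.exists_face hnadj h3,
    fun C hC _ e he hb => hb.exists_disjoint_paths hne hnadj h3 hC he⟩
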